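/- Let $\mathcal N$ and $\mathcal M$ be von Neumann algebras with faithful normal states $\varphi$ and $\psi$, and let $\mathcal N\otimes\mathcal M$ be their von Neumann algebra tensor product, with the product state $\omega=\varphi\otimes\psi$. For $1\le p\le\infty$ let $L^p(\mathcal N\otimes\mathcal M)=(\mathcal N\otimes\mathcal M,(\mathcal N\otimes\mathcal M)_*)_{[1/p]}$ be the non-commutative $L^p$-space, that is, the complex interpolation space of the couple given by the left injection $x\mapsto x\omega$, $(x\omega)(y)=\omega(yx)$, and let $i^p:\mathcal N\otimes\mathcal M\to L^p(\mathcal N\otimes\mathcal M)$ be the canonical embedding. Let $E_{\mathcal N}=\iota\otimes\psi:\mathcal N\otimes\mathcal M\to\mathcal N\otimes 1$ and $E_{\mathcal M}=\varphi\otimes\iota:\mathcal N\otimes\mathcal M\to 1\otimes\mathcal M$ be the $\omega$-preserving conditional expectations. Let $(u_i)_{i\ge 0}$ in $\mathcal N$ and $(v_j)_{j\ge 0}$ in $\mathcal M$ be sequences of linearly independent unitaries, and let $F^p_{\mathcal N,j}$ and $F^p_{\mathcal M,i}$ be the bounded maps on $L^p(\mathcal N\otimes\mathcal M)$ obtained by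 complex interpolation from $$F_{\mathcal N,j}(x)=(1\otimes v_j)\,E_{\mathcal N}\big((1\otimes v_j^*)x\big),\qquad F_{\mathcal M,i}(x)=(u_i\otimes 1)\,E_{\mathcal M}\big((u_i^*\otimes 1)x\big).$$ Suppose that $\big(F^p_{\mathcal N,j}(L^p(\mathcal N\otimes\mathcal M))\big)_{j\ge0}$ and $\big(F^p_{\mathcal M,i}(L^p(\mathcal N\otimes\mathcal M))\big)_{i\ge0}$ are Schauder decompositions of $L^p(\mathcal N\otimes\mathcal M)$, i.e. sequences of closed subspaces $X_s$ such that every $x$ has a unique expansion $x=\sum_{s=0}^\infty x_s$ (norm convergent partial sums) with $x_s\in X_s$. Then the vectors $i^p(u_i\otimes v_j)$, listed in the shell enumeration in which $(i,j)$ has the number $j^2+i$ if $i\le j$ and $(i+1)^2-j-1$ if $i>j$, form a Schauder basis of $L^p(\mathcal N\otimes\mathcal M)$. -/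

import Mathlib

open Filter Set
open scoped Topology ENNReal TensorProduct InnerProductSpace ZeroAtInfty ComplexOrder

noncomputable section

namespace NCLp

/-! ### Complex interpolation of a couple `A₀ ↪ A₁` -/

section Interpolation

variable {A₀ A₁ : Type*} [NormedAddCommGroup A₀] [NormedSpace ℂ A₀]
  [NormedAddCommGroup A₁] [NormedSpace ℂ A₁]

/-- Calderón's class of functions on the strip `0 ≤ Re z ≤ 1` for the couple `(A₀, A₁)`, where `A₀`
is included in `A₁` by `ι` (so that `A₀ + A₁ = A₁`): `f` is bounded and continuous on the closed
strip and analytic inside, `t ↦ f (i t)` is a continuous function `g` into `A₀` vanishing at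
infinity, and `t ↦ f (1 + i t)` is a continuous function `h` into `A₁` vanishing at infinity. -/
structure IsCalderon (ι : A₀ →L[ℂ] A₁) (f : ℂ → A₁) (g : C₀(ℝ, A₀)) (h : C₀(ℝ, A₁)) : Prop where
  continuousOn : ContinuousOn f (Complex.re ⁻¹' Icc 0 1)
  bounded : ∃ C : ℝ, ∀ z ∈ Complex.re ⁻¹' Icc 0 1, ‖f z‖ ≤ C
  differentiableOn : DifferentiableOn ℂ f (Complex.re ⁻¹' Ioo 0 1)
  left_eq : ∀ t : ℝ, f (t * Complex.I) = ι (g t)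
  right_eq : ∀ t : ℝ, f (1 + t * Complex.I) = h t

variable {ι : A₀ →L[ℂ] A₁}

theorem IsCalderon.zero : IsCalderon ι 0 0 0 where
  continuousOn := continuousOn_const
  bounded := ⟨0, by simp⟩
  differentiableOn := differentiableOn_const _
  left_eq := by simp
  right_eq := by simp

theorem IsCalderon.add {f f' : ℂ → A₁} {g g' : C₀(ℝ, A₀)} {h h' : C₀(ℝ, A₁)}
    (H : IsCalderon ι f g h) (H' : IsCalderon ι f' g' h') :
    IsCalderon ι (f + f') (g + g') (h + h') where
  continuousOn := H.continuousOn.add H'.continuousOn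
  bounded := by
    obtain ⟨C, hC⟩ := H.bounded
    obtain ⟨C', hC'⟩ := H'.bounded
    exact ⟨C + C', fun z hz => (norm_add_le _ _).trans (add_le_add (hC z hz) (hC' z hz))⟩
  differentiableOn := H.differentiableOn.add H'.differentiableOn
  left_eq t := by simp [H.left_eq, H'.left_eq]
  right_eq t := by simp [H.right_eq, H'.right_eq]

theorem IsCalderon.smul (c : ℂ) {f : ℂ → A₁} {g : C₀(ℝ, A₀)} {h : C₀(ℝ, A₁)}
    (H : IsCalderon ι f g h) : IsCalderon ι (c • f) (c • g) (c • h) where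
  continuousOn := H.continuousOn.const_smul c
  bounded := by
    obtain ⟨C, hC⟩ := H.bounded
    refine ⟨‖c‖ * C, fun z hz => ?_⟩
    rw [Pi.smul_apply, norm_smul]
    exact mul_le_mul_of_nonneg_left (hC z hz) (norm_nonneg c)
  differentiableOn := H.differentiableOn.const_smul c
  left_eq t := by simp [H.left_eq]
  right_eq t := by simp [H.right_eq]

theorem C₀_norm_apply_le {E : Type*} [NormedAddCommGroup E] (g : C₀(ℝ, E)) (t : ℝ) :
    ‖g t‖ ≤ ‖g‖ := by
  rw [← ZeroAtInftyContinuousMap.norm_toBCF_eq_norm]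
  exact g.toBCF.norm_coe_le_norm t

/-- Maximum principle on the strip. -/
theorem IsCalderon.norm_le {f : ℂ → A₁} {g : C₀(ℝ, A₀)} {h : C₀(ℝ, A₁)}
    (H : IsCalderon ι f g h) {z : ℂ} (hz : z ∈ Complex.re ⁻¹' Icc 0 1) :
    ‖f z‖ ≤ max 1 ‖ι‖ * max ‖g‖ ‖h‖ := by
  have hcl : closure (Complex.re ⁻¹' Ioo 0 1) = Complex.re ⁻¹' Icc (0 : ℝ) 1 := by
    rw [Complex.closure_preimage_re, closure_Ioo zero_ne_one]
  have hne : (0 : ℝ) ≤ max ‖g‖ ‖h‖ := (norm_nonneg g).trans (le_max_left _ _)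
  refine PhragmenLindelof.vertical_strip (a := 0) (b := 1) (f := f)
    ⟨H.differentiableOn, by rw [hcl]; exact H.continuousOn⟩ ?_ ?_ ?_ hz.1 hz.2
  · obtain ⟨C, hC⟩ := H.bounded
    refine ⟨0, by simpa using Real.pi_pos, 0, ?_⟩
    refine Asymptotics.IsBigO.of_bound C ?_
    refine eventually_inf_principal.2 (Eventually.of_forall fun w hw => ?_)
    simpa using hC w ⟨hw.1.le, hw.2.le⟩
  · intro w hw
    have e : w = (w.im : ℂ) * Complex.I := by
      apply Complex.ext <;> simp [hw]
    rw [e, H.left_eq]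
    calc ‖ι (g w.im)‖ ≤ ‖ι‖ * ‖g w.im‖ := ι.le_opNorm _
      _ ≤ max 1 ‖ι‖ * max ‖g‖ ‖h‖ := by
        gcongr
        · exact le_max_right _ _
        · exact (C₀_norm_apply_le g _).trans (le_max_left _ _)
  · intro w hw
    have e : w = 1 + (w.im : ℂ) * Complex.I := by
      apply Complex.ext <;> simp [hw]
    rw [e, H.right_eq]
    calc ‖h w.im‖ ≤ max ‖g‖ ‖h‖ := (C₀_norm_apply_le h _).trans (le_max_right _ _)
      _ ≤ max 1 ‖ι‖ * max ‖g‖ ‖h‖ := le_mul_of_one_le_left hne (le_max_left _ _)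

/-- The underlying vector space of the complex interpolation space `(A₀, A₁)_[θ]`, as a subspace
of `A₁`: the values `f θ` of the functions of Calderón's class. -/
def interpSubmodule (ι : A₀ →L[ℂ] A₁) (θ : unitInterval) : Submodule ℂ A₁ where
  carrier := {a | ∃ f g h, IsCalderon ι f g h ∧ f ((θ : ℝ) : ℂ) = a}
  zero_mem' := ⟨0, 0, 0, IsCalderon.zero, rfl⟩
  add_mem' := by
    rintro _ _ ⟨f, g, h, H, rfl⟩ ⟨f', g', h', H', rfl⟩
    exact ⟨_, _, _, H.add H', rfl⟩
  smul_mem' := by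
    rintro c _ ⟨f, g, h, H, rfl⟩
    exact ⟨_, _, _, H.smul c, rfl⟩

/-- The complex interpolation space `(A₀, A₁)_[θ]`, `0 ≤ θ ≤ 1`; its norm is the interpolation
norm below, not the norm of `A₁`. -/
def Interp (ι : A₀ →L[ℂ] A₁) (θ : unitInterval) : Type _ := ↥(interpSubmodule ι θ)

namespace Interp

variable {θ : unitInterval}

instance : AddCommGroup (Interp ι θ) := inferInstanceAs (AddCommGroup ↥(interpSubmodule ι θ))

instance : Module ℂ (Interp ι θ) := inferInstanceAs (Module ℂ ↥(interpSubmodule ι θ))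

variable (ι θ) in
/-- The inclusion of `(A₀, A₁)_[θ]` in `A₁`. -/
def val : Interp ι θ →ₗ[ℂ] A₁ := (interpSubmodule ι θ).subtype

theorem val_injective : Function.Injective (val ι θ) := Subtype.val_injective

/-- The values `max (sup ‖f (i t)‖) (sup ‖f (1 + i t)‖)` over the `f` with `f θ = a`. -/
def normSet (a : Interp ι θ) : Set ℝ :=
  {C | ∃ f g h, IsCalderon ι f g h ∧ f ((θ : ℝ) : ℂ) = val ι θ a ∧ C = max ‖g‖ ‖h‖}

/-- The interpolation norm. -/
instance : Norm (Interp ι θ) := ⟨fun a => sInf (normSet a)⟩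

theorem norm_def (a : Interp ι θ) : ‖a‖ = sInf (normSet a) := rfl

theorem normSet_nonempty (a : Interp ι θ) : (normSet a).Nonempty := by
  obtain ⟨f, g, h, H, e⟩ := a.2
  exact ⟨_, f, g, h, H, e, rfl⟩

theorem normSet_nonneg (a : Interp ι θ) : ∀ C ∈ normSet a, 0 ≤ C := by
  rintro _ ⟨f, g, h, -, -, rfl⟩
  exact (norm_nonneg g).trans (le_max_left _ _)

theorem normSet_bddBelow (a : Interp ι θ) : BddBelow (normSet a) := ⟨0, normSet_nonneg a⟩

theorem norm_le_of {a : Interp ι θ} {f : ℂ → A₁} {g : C₀(ℝ, A₀)} {h : C₀(ℝ, A₁)}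
    (H : IsCalderon ι f g h) (e : f ((θ : ℝ) : ℂ) = val ι θ a) : ‖a‖ ≤ max ‖g‖ ‖h‖ :=
  csInf_le (normSet_bddBelow a) ⟨f, g, h, H, e, rfl⟩

theorem exists_of_lt {a : Interp ι θ} {C : ℝ} (hC : ‖a‖ < C) :
    ∃ f g h, IsCalderon ι f g h ∧ f ((θ : ℝ) : ℂ) = val ι θ a ∧ max ‖g‖ ‖h‖ < C := by
  obtain ⟨_, ⟨f, g, h, H, e, rfl⟩, hlt⟩ := exists_lt_of_csInf_lt (normSet_nonempty a) hC
  exact ⟨f, g, h, H, e, hlt⟩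

theorem norm_val_le (a : Interp ι θ) : ‖val ι θ a‖ ≤ max 1 ‖ι‖ * ‖a‖ := by
  have hpos : 0 < max 1 ‖ι‖ := lt_max_of_lt_left one_pos
  rw [← div_le_iff₀' hpos]
  refine le_csInf (normSet_nonempty a) ?_
  rintro _ ⟨f, g, h, H, e, rfl⟩
  rw [div_le_iff₀' hpos, ← e]
  exact H.norm_le (by simp)

theorem norm_smul_le' (c : ℂ) (a : Interp ι θ) : ‖c • a‖ ≤ ‖c‖ * ‖a‖ := by
  refine le_of_forall_pos_lt_add fun ε hε => ?_
  obtain ⟨f, g, h, H, e, hlt⟩ := exists_of_lt (a := a) (C := ‖a‖ + ε / (‖c‖ + 1))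
    (lt_add_of_pos_right _ (by positivity))
  refine (norm_le_of (H.smul c) (by simp [e])).trans_lt ?_
  rw [norm_smul, norm_smul, ← mul_max_of_nonneg _ _ (norm_nonneg c)]
  have h1 : ‖c‖ * (ε / (‖c‖ + 1)) < ε := by
    rw [← mul_div_assoc, div_lt_iff₀ (by positivity)]
    nlinarith [norm_nonneg c]
  have h2 := mul_le_mul_of_nonneg_left hlt.le (norm_nonneg c)
  linarith [mul_add ‖c‖ ‖a‖ (ε / (‖c‖ + 1))]

theorem core : NormedSpace.Core ℂ (Interp ι θ) where
  norm_nonneg a := Real.sInf_nonneg (normSet_nonneg a)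
  norm_smul c a := by
    refine le_antisymm (norm_smul_le' c a) ?_
    rcases eq_or_ne c 0 with rfl | hc
    · rw [norm_zero, zero_mul]
      exact Real.sInf_nonneg (normSet_nonneg _)
    · have := norm_smul_le' c⁻¹ (c • a)
      rw [smul_smul, inv_mul_cancel₀ hc, one_smul, norm_inv] at this
      rwa [← inv_mul_le_iff₀ (by positivity), inv_inv] at this
  norm_triangle a b := by
    refine le_of_forall_pos_lt_add fun ε hε => ?_
    obtain ⟨f, g, h, H, e, hlt⟩ := exists_of_lt (lt_add_of_pos_right ‖a‖ (half_pos hε))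
    obtain ⟨f', g', h', H', e', hlt'⟩ := exists_of_lt (lt_add_of_pos_right ‖b‖ (half_pos hε))
    refine (norm_le_of (H.add H') (by simp [e, e'])).trans_lt ?_
    refine (max_le_max (norm_add_le g g') (norm_add_le h h')).trans_lt ?_
    refine max_lt ?_ ?_
    · linarith [le_max_left ‖g‖ ‖h‖, le_max_left ‖g'‖ ‖h'‖]
    · linarith [le_max_right ‖g‖ ‖h‖, le_max_right ‖g'‖ ‖h'‖]
  norm_eq_zero_iff a := by
    constructor
    · intro h0
      apply val_injective
      rw [map_zero, ← norm_le_zero_iff]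
      simpa [h0] using norm_val_le a
    · rintro rfl
      refine le_antisymm ?_ (Real.sInf_nonneg (normSet_nonneg _))
      simpa using norm_le_of (a := (0 : Interp ι θ)) IsCalderon.zero (by simp)

instance : NormedAddCommGroup (Interp ι θ) := NormedAddCommGroup.ofCore core

instance : NormedSpace ℂ (Interp ι θ) := NormedSpace.ofCore core

/-- A Gaussian times a constant vector, in `C₀(ℝ, E)`. -/
def gauss {E : Type*} [NormedAddCommGroup E] [NormedSpace ℂ E] (s : ℂ) (a : E) : C₀(ℝ, E) where
  toFun t := Complex.exp ((s + t * Complex.I) ^ 2) • a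
  continuous_toFun := by fun_prop
  zero_at_infty' := by
    have h1 : Tendsto (fun t : ℝ => Complex.exp ((s + t * Complex.I) ^ 2)) (cocompact ℝ) (𝓝 0) := by
      rw [tendsto_zero_iff_norm_tendsto_zero]
      have e : ∀ t : ℝ, ‖Complex.exp ((s + t * Complex.I) ^ 2)‖
          = Real.exp (-((s.im + t) ^ 2) + s.re ^ 2) := by
        intro t
        rw [Complex.norm_exp]
        congr 1
        simp [pow_two]
        ring
      simp_rw [e]
      refine Real.tendsto_exp_atBot.comp (tendsto_atBot_add_const_right _ _ ?_)
      refine tendsto_neg_atTop_atBot.comp ?_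
      have h2 : Tendsto (fun t : ℝ => ‖s.im + t‖) (cocompact ℝ) atTop :=
        tendsto_norm_cocompact_atTop.comp
          (Homeomorph.addLeft s.im).isClosedEmbedding.tendsto_cocompact
      have h3 := (tendsto_pow_atTop (two_ne_zero)).comp h2
      refine h3.congr fun t => ?_
      simp
    simpa using h1.smul_const a

theorem incl_mem (a : A₀) : ι a ∈ interpSubmodule ι θ := by
  set s : ℂ := Complex.exp (-((θ : ℝ) : ℂ) ^ 2)
  refine ⟨fun z => Complex.exp (z ^ 2) • ι (s • a), gauss 0 (s • a), gauss 1 (ι (s • a)),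
    ⟨?_, ?_, ?_, ?_, ?_⟩, ?_⟩
  · exact Continuous.continuousOn (by fun_prop)
  · refine ⟨Real.exp 1 * ‖ι (s • a)‖, fun z hz => ?_⟩
    rw [norm_smul, Complex.norm_exp]
    gcongr
    have h0 : 0 ≤ z.re := hz.1
    have h1 : z.re ≤ 1 := hz.2
    simp only [pow_two, Complex.mul_re]
    nlinarith [mul_self_nonneg z.im]
  · exact Differentiable.differentiableOn (by fun_prop)
  · intro t; simp [gauss]
  · intro t; simp [gauss]
  · simp only [s, map_smul, smul_smul, ← Complex.exp_add]
    simp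

variable (ι θ) in
/-- The embedding of `A₀` in `(A₀, A₁)_[θ]`. -/
def incl : A₀ →ₗ[ℂ] Interp ι θ := (ι : A₀ →ₗ[ℂ] A₁).codRestrict (interpSubmodule ι θ) incl_mem

theorem val_incl (a : A₀) : val ι θ (incl ι θ a) = ι a := rfl

variable {B₀ B₁ : Type*} [NormedAddCommGroup B₀] [NormedSpace ℂ B₀]
  [NormedAddCommGroup B₁] [NormedSpace ℂ B₁] {κ : B₀ →L[ℂ] B₁}

/-- Post-composition with a bounded operator on `C₀(ℝ, E)`. -/
def compC₀ {E F : Type*} [NormedAddCommGroup E] [NormedSpace ℂ E] [NormedAddCommGroup F]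
    [NormedSpace ℂ F] (T : E →L[ℂ] F) (g : C₀(ℝ, E)) : C₀(ℝ, F) where
  toFun t := T (g t)
  continuous_toFun := T.continuous.comp g.continuous
  zero_at_infty' := by
    have h := (T.continuous.tendsto 0).comp g.zero_at_infty'
    rwa [map_zero] at h

theorem norm_compC₀_le {E F : Type*} [NormedAddCommGroup E] [NormedSpace ℂ E]
    [NormedAddCommGroup F] [NormedSpace ℂ F] (T : E →L[ℂ] F) (g : C₀(ℝ, E)) :
    ‖compC₀ T g‖ ≤ ‖T‖ * ‖g‖ := by
  rw [← ZeroAtInftyContinuousMap.norm_toBCF_eq_norm]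
  refine (BoundedContinuousFunction.norm_le (by positivity)).2 fun t => ?_
  exact (T.le_opNorm _).trans (mul_le_mul_of_nonneg_left (C₀_norm_apply_le g t) (norm_nonneg T))

theorem isCalderon_comp {T₀ : A₀ →L[ℂ] B₀} {T₁ : A₁ →L[ℂ] B₁} (hT : ∀ a, T₁ (ι a) = κ (T₀ a))
    {f : ℂ → A₁} {g : C₀(ℝ, A₀)} {h : C₀(ℝ, A₁)} (H : IsCalderon ι f g h) :
    IsCalderon κ (fun z => T₁ (f z)) (compC₀ T₀ g) (compC₀ T₁ h) where
  continuousOn := T₁.continuous.comp_continuousOn H.continuousOn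
  bounded := by
    obtain ⟨C, hC⟩ := H.bounded
    exact ⟨‖T₁‖ * C, fun z hz => (T₁.le_opNorm _).trans
      (mul_le_mul_of_nonneg_left (hC z hz) (norm_nonneg T₁))⟩
  differentiableOn := T₁.differentiable.comp_differentiableOn H.differentiableOn
  left_eq t := by simp [H.left_eq, hT, compC₀]
  right_eq t := by simp [H.right_eq, compC₀]

/-- The interpolated map `(A₀, A₁)_[θ] → (B₀, B₁)_[θ]` of a morphism `(T₀, T₁)` of couples; it is
the restriction of `T₁`. -/
def map (T₀ : A₀ →L[ℂ] B₀) (T₁ : A₁ →L[ℂ] B₁) (hT : ∀ a, T₁ (ι a) = κ (T₀ a))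
    (θ : unitInterval) : Interp ι θ →L[ℂ] Interp κ θ :=
  LinearMap.mkContinuous
    (((T₁ : A₁ →ₗ[ℂ] B₁) ∘ₗ val ι θ).codRestrict (interpSubmodule κ θ) (by
      rintro ⟨_, f, g, h, H, rfl⟩
      exact ⟨_, _, _, isCalderon_comp hT H, rfl⟩) : Interp ι θ →ₗ[ℂ] Interp κ θ)
    (max ‖T₀‖ ‖T₁‖) (by
      intro a
      rcases (le_max_of_le_left (norm_nonneg T₀) : 0 ≤ max ‖T₀‖ ‖T₁‖).eq_or_lt with h0 | hpos
      · have hT0 : ‖T₀‖ ≤ 0 := h0 ▸ le_max_left _ _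
        have hT1 : ‖T₁‖ ≤ 0 := h0 ▸ le_max_right _ _
        obtain ⟨f, g, h, H, e⟩ := a.2
        refine (norm_le_of (isCalderon_comp hT H) (congrArg T₁ e)).trans ?_
        rw [← h0, zero_mul]
        exact max_le
          ((norm_compC₀_le _ _).trans (mul_nonpos_of_nonpos_of_nonneg hT0 (norm_nonneg _)))
          ((norm_compC₀_le _ _).trans (mul_nonpos_of_nonpos_of_nonneg hT1 (norm_nonneg _)))
      · rw [← div_le_iff₀' hpos]
        refine le_csInf (normSet_nonempty a) ?_
        rintro _ ⟨f, g, h, H, e, rfl⟩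
        rw [div_le_iff₀' hpos]
        refine (norm_le_of (isCalderon_comp hT H) (congrArg T₁ e)).trans ?_
        refine max_le ((norm_compC₀_le _ _).trans ?_) ((norm_compC₀_le _ _).trans ?_)
        · gcongr <;> exact le_max_left _ _
        · gcongr <;> exact le_max_right _ _)

theorem val_map (T₀ : A₀ →L[ℂ] B₀) (T₁ : A₁ →L[ℂ] B₁) (hT : ∀ a, T₁ (ι a) = κ (T₀ a))
    (a : Interp ι θ) : val κ θ (map T₀ T₁ hT θ a) = T₁ (val ι θ a) := rfl

end Interp

end Interpolation

/-! ### Von Neumann algebras, preduals, and non-commutative `L^p`-spaces -/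

section VonNeumann

variable {H : Type*} [NormedAddCommGroup H] [InnerProductSpace ℂ H] [CompleteSpace H]

/-- The elements of a von Neumann algebra, with the operator norm. -/
def El (N : VonNeumannAlgebra H) : Type _ := ↥N.toStarSubalgebra

instance (N : VonNeumannAlgebra H) : NormedRing (El N) :=
  inferInstanceAs (NormedRing ↥N.toStarSubalgebra)

instance (N : VonNeumannAlgebra H) : NormedAlgebra ℂ (El N) :=
  inferInstanceAs (NormedAlgebra ℂ ↥N.toStarSubalgebra)

instance (N : VonNeumannAlgebra H) : StarRing (El N) :=
  inferInstanceAs (StarRing ↥N.toStarSubalgebra)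

instance (N : VonNeumannAlgebra H) : NormedAddCommGroup (El N) := inferInstance

instance (N : VonNeumannAlgebra H) : NormedSpace ℂ (El N) := inferInstance

namespace El

variable {N : VonNeumannAlgebra H}

/-- The operator underlying an element of `N`. -/
def op (x : El N) : H →L[ℂ] H := Subtype.val x

/-- An operator that lies in `N`, as an element of `N`. -/
def mk (x : H →L[ℂ] H) (hx : x ∈ N) : El N := ⟨x, hx⟩

theorem op_mem (x : El N) : x.op ∈ N := Subtype.property x

theorem ext {x y : El N} (h : x.op = y.op) : x = y := Subtype.ext h

@[simp] theorem op_mk (x : H →L[ℂ] H) (hx : x ∈ N) : (mk x hx).op = x := rfl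
@[simp] theorem op_add (x y : El N) : (x + y).op = x.op + y.op := rfl
@[simp] theorem op_smul (c : ℂ) (x : El N) : (c • x).op = c • x.op := rfl
@[simp] theorem op_mul (x y : El N) : (x * y).op = x.op * y.op := rfl
@[simp] theorem op_one : (1 : El N).op = 1 := rfl
@[simp] theorem op_star (x : El N) : (star x).op = star x.op := rfl

theorem norm_op (x : El N) : ‖x.op‖ = ‖x‖ := rfl

variable (N) in
/-- The isometric inclusion of `N` in the bounded operators. -/
def opL : El N →L[ℂ] (H →L[ℂ] H) := N.toStarSubalgebra.toSubalgebra.toSubmodule.subtypeL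

end El

/-- The functional `x ↦ ⟨ξ, x η⟩` on `N`. -/
def vecFunctional (N : VonNeumannAlgebra H) (ξ η : H) : StrongDual ℂ (El N) :=
  (innerSL ℂ ξ) ∘L (ContinuousLinearMap.apply ℂ H η) ∘L
    El.opL N

@[simp]
theorem vecFunctional_apply (N : VonNeumannAlgebra H) (ξ η : H) (x : El N) :
    vecFunctional N ξ η x = ⟪ξ, x.op η⟫_ℂ := rfl

/-- The predual `N_*`: the normal functionals on `N`, that is, the norm closure in the dual of `N`
of the linear span of the vector functionals `x ↦ ⟨ξ, x η⟩`. -/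
def predual (N : VonNeumannAlgebra H) : Submodule ℂ (StrongDual ℂ (El N)) :=
  (Submodule.span ℂ (range fun p : H × H => vecFunctional N p.1 p.2)).topologicalClosure

theorem vecFunctional_mem (N : VonNeumannAlgebra H) (ξ η : H) : vecFunctional N ξ η ∈ predual N :=
  Submodule.le_topologicalClosure _ (Submodule.subset_span ⟨(ξ, η), rfl⟩)

/-- A closed condition on normal functionals can be checked on vector functionals. -/
theorem predual_induction {N : VonNeumannAlgebra H} {V : Submodule ℂ (StrongDual ℂ (El N))}
    (hV : IsClosed (V : Set (StrongDual ℂ (El N)))) (h : ∀ ξ η, vecFunctional N ξ η ∈ V)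
    {ω : StrongDual ℂ (El N)} (hω : ω ∈ predual N) : ω ∈ V := by
  refine Submodule.topologicalClosure_minimal _ (Submodule.span_le.2 ?_) hV hω
  rintro _ ⟨p, rfl⟩
  exact h _ _

theorem predual_isClosed (N : VonNeumannAlgebra H) :
    IsClosed (predual N : Set (StrongDual ℂ (El N))) :=
  Submodule.isClosed_topologicalClosure _

/-- The predual of `N` as a Banach space. -/
def Predual (N : VonNeumannAlgebra H) : Type _ := ↥(predual N)

instance (N : VonNeumannAlgebra H) : NormedAddCommGroup (Predual N) :=
  inferInstanceAs (NormedAddCommGroup ↥(predual N))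

instance (N : VonNeumannAlgebra H) : NormedSpace ℂ (Predual N) :=
  inferInstanceAs (NormedSpace ℂ ↥(predual N))

namespace Predual

variable {N : VonNeumannAlgebra H}

variable (N) in
/-- The inclusion of the predual in the dual of `N`. -/
def dualL : Predual N →L[ℂ] StrongDual ℂ (El N) := (predual N).subtypeL

/-- The functional underlying an element of the predual. -/
def toDual (ω : Predual N) : StrongDual ℂ (El N) := dualL N ω

instance : CoeFun (Predual N) fun _ => El N → ℂ := ⟨fun ω => ω.toDual⟩

theorem toDual_mem (ω : Predual N) : ω.toDual ∈ predual N := Subtype.property ω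

theorem ext {ω ω' : Predual N} (h : ∀ x, ω x = ω' x) : ω = ω' :=
  Subtype.ext (ContinuousLinearMap.ext h)

@[simp] theorem add_apply (ω ω' : Predual N) (x : El N) : (ω + ω') x = ω x + ω' x := rfl
@[simp] theorem smul_apply (c : ℂ) (ω : Predual N) (x : El N) : (c • ω) x = c * ω x := rfl

theorem norm_toDual (ω : Predual N) : ‖ω.toDual‖ = ‖ω‖ := rfl

end Predual

variable {L : Type*} [NormedAddCommGroup L] [InnerProductSpace ℂ L] [CompleteSpace L]

/-- The map `ω ↦ ω ∘ R` of preduals, for a bounded normal linear map `R : A → B`. -/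
def predualMap {A : VonNeumannAlgebra H} {B : VonNeumannAlgebra L} (R : El A →L[ℂ] El B)
    (hR : ∀ ξ η, vecFunctional B ξ η ∘L R ∈ predual A) : Predual B →L[ℂ] Predual A :=
  ((ContinuousLinearMap.precomp ℂ R) ∘L Predual.dualL B).codRestrict (predual A) (by
    intro ω
    let T : StrongDual ℂ (El B) →L[ℂ] StrongDual ℂ (El A) := ContinuousLinearMap.precomp ℂ R
    let V : Submodule ℂ (StrongDual ℂ (El B)) := (predual A).comap T.toLinearMap
    have hV : IsClosed (V : Set (StrongDual ℂ (El B))) :=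
      (predual_isClosed A).preimage T.continuous
    exact predual_induction hV hR ω.toDual_mem)

@[simp]
theorem predualMap_apply {A : VonNeumannAlgebra H} {B : VonNeumannAlgebra L} (R : El A →L[ℂ] El B)
    (hR : ∀ ξ η, vecFunctional B ξ η ∘L R ∈ predual A) (ω : Predual B) (x : El A) :
    predualMap R hR ω x = ω (R x) := rfl

/-- Left multiplication `y ↦ x y` on `N`. -/
def lmul (N : VonNeumannAlgebra H) (x : El N) : El N →L[ℂ] El N := ContinuousLinearMap.mul ℂ (El N) x

/-- Left multiplication on the predual: `(x ω)(y) = ω (y x)`. -/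
def lmulPredual (N : VonNeumannAlgebra H) (x : El N) : Predual N →L[ℂ] Predual N :=
  predualMap ((ContinuousLinearMap.mul ℂ (El N)).flip x) fun ξ η => by
    exact vecFunctional_mem N ξ (x.op η)

@[simp]
theorem lmulPredual_apply (N : VonNeumannAlgebra H) (x y : El N) (ω : Predual N) :
    lmulPredual N x ω y = ω (y * x) := rfl

/-- The left injection `x ↦ x ω` of `N` in `N_*`. -/
def leftInj (N : VonNeumannAlgebra H) (ω : Predual N) : El N →L[ℂ] Predual N :=
  LinearMap.mkContinuous
    { toFun := fun x => lmulPredual N x ω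
      map_add' := fun x y => Predual.ext fun z => by simp [mul_add]
      map_smul' := fun c x => Predual.ext fun z => by simp }
    ‖ω‖ (fun x => ContinuousLinearMap.opNorm_le_bound _ (by positivity) fun y => by
      calc ‖ω (y * x)‖ ≤ ‖ω‖ * ‖y * x‖ :=
            ω.toDual.le_opNorm _
        _ ≤ ‖ω‖ * (‖y‖ * ‖x‖) := by gcongr; exact norm_mul_le _ _
        _ = ‖ω‖ * ‖x‖ * ‖y‖ := by ring)

@[simp]
theorem leftInj_apply (N : VonNeumannAlgebra H) (ω : Predual N) (x y : El N) :
    leftInj N ω x y = ω (y * x) := rfl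

/-- Faithful normal states. Normality is membership in the predual. -/
structure IsFaithfulState {N : VonNeumannAlgebra H} (ω : Predual N) : Prop where
  nonneg : ∀ x : El N, 0 ≤ ω (star x * x)
  map_one : ω 1 = 1
  faithful : ∀ x : El N, ω (star x * x) = 0 → x = 0

/-- The interpolation parameter `1 / p`, for `1 ≤ p ≤ ∞`. -/
def param (p : ℝ≥0∞) [hp : Fact (1 ≤ p)] : unitInterval :=
  ⟨(p⁻¹).toReal, ENNReal.toReal_nonneg, by
    have h : p⁻¹ ≤ 1 := ENNReal.inv_le_one.2 hp.out
    simpa using ENNReal.toReal_mono ENNReal.one_ne_top h⟩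

/-- The non-commutative space `L^p(N) = (N, N_*)_[1/p]` with respect to the left injection
`x ↦ x ω`. -/
abbrev Lp (N : VonNeumannAlgebra H) (ω : Predual N) (p : ℝ≥0∞) [Fact (1 ≤ p)] : Type _ :=
  Interp (A₀ := El N) (A₁ := Predual N) (leftInj N ω) (param p)

/-- The embedding `i^p : N → L^p(N)`. -/
def toLp (N : VonNeumannAlgebra H) (ω : Predual N) (p : ℝ≥0∞) [Fact (1 ≤ p)] :
    El N →ₗ[ℂ] Lp N ω p :=
  Interp.incl (A₀ := El N) (A₁ := Predual N) (leftInj N ω) (param p)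

/-- The von Neumann algebra generated by a set of operators: the double commutant of its
self-adjoint hull. -/
def vnGen (S : Set (H →L[ℂ] H)) : VonNeumannAlgebra H where
  toStarSubalgebra := StarSubalgebra.centralizer ℂ (StarSubalgebra.centralizer ℂ S : Set (H →L[ℂ] H))
  centralizer_centralizer' := by simp

theorem subset_vnGen (S : Set (H →L[ℂ] H)) : S ⊆ (vnGen S).toStarSubalgebra := by
  intro x hx
  change x ∈ StarSubalgebra.centralizer ℂ (StarSubalgebra.centralizer ℂ S : Set (H →L[ℂ] H))
  rw [StarSubalgebra.mem_centralizer_iff]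
  intro g hg
  rw [SetLike.mem_coe, StarSubalgebra.mem_centralizer_iff] at hg
  refine ⟨((hg x hx).1).symm, ?_⟩
  have h := congrArg star (hg x hx).2
  simpa using h

theorem commute_of_mem_vnGen {S : Set (H →L[ℂ] H)} {x z : H →L[ℂ] H}
    (hx : x ∈ (vnGen S).toStarSubalgebra)
    (hz : ∀ s ∈ S, s * z = z * s) (hz' : ∀ s ∈ S, s * star z = star z * s) : z * x = x * z := by
  change x ∈ StarSubalgebra.centralizer ℂ (StarSubalgebra.centralizer ℂ S : Set (H →L[ℂ] H)) at hx
  rw [StarSubalgebra.mem_centralizer_iff] at hx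
  refine (hx z ?_).1
  rw [SetLike.mem_coe, StarSubalgebra.mem_centralizer_iff]
  refine fun s hs => ⟨hz s hs, ?_⟩
  have h := congrArg star (hz' s hs)
  simpa using h.symm

end VonNeumann

/-! ### Tensor products of von Neumann algebras -/

section Tensor

variable {H K L : Type*} [NormedAddCommGroup H] [InnerProductSpace ℂ H] [CompleteSpace H]
  [NormedAddCommGroup K] [InnerProductSpace ℂ K] [CompleteSpace K]
  [NormedAddCommGroup L] [InnerProductSpace ℂ L] [CompleteSpace L]

variable (H K) in
/-- The Hilbert space tensor product. -/
def HTensor : Type _ := UniformSpace.Completion (H ⊗[ℂ] K)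

instance : NormedAddCommGroup (HTensor H K) :=
  inferInstanceAs (NormedAddCommGroup (UniformSpace.Completion (H ⊗[ℂ] K)))

instance : InnerProductSpace ℂ (HTensor H K) :=
  inferInstanceAs (InnerProductSpace ℂ (UniformSpace.Completion (H ⊗[ℂ] K)))

instance : CompleteSpace (HTensor H K) :=
  inferInstanceAs (CompleteSpace (UniformSpace.Completion (H ⊗[ℂ] K)))

variable (H K) in
/-- The canonical map from the algebraic to the Hilbert space tensor product. -/
def HTensor.ofAlg : H ⊗[ℂ] K →L[ℂ] HTensor H K :=
  (UniformSpace.Completion.toComplL : H ⊗[ℂ] K →L[ℂ] UniformSpace.Completion (H ⊗[ℂ] K))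

variable (H K) in
/-- The bilinear map `(h, k) ↦ h ⊗ k`. -/
def tmulL : H →L[ℂ] K →L[ℂ] HTensor H K :=
  (ContinuousLinearMap.compL ℂ K (H ⊗[ℂ] K) (HTensor H K) (HTensor.ofAlg H K)) ∘L
    TensorProduct.mkL ℂ H K

theorem tmulL_apply (h : H) (k : K) :
    tmulL H K h k = HTensor.ofAlg H K (h ⊗ₜ[ℂ] k) := rfl

theorem inner_tmulL (h h' : H) (k k' : K) :
    ⟪tmulL H K h k, tmulL H K h' k'⟫_ℂ = ⟪h, h'⟫_ℂ * ⟪k, k'⟫_ℂ := by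
  exact (UniformSpace.Completion.inner_coe _ _).trans (TensorProduct.inner_tmul _ _ _ _ _)

/-- A closed subspace containing the elementary tensors is everything. -/
theorem htensor_induction {V : Submodule ℂ (HTensor H K)} (hV : IsClosed (V : Set (HTensor H K)))
    (h : ∀ a b, tmulL H K a b ∈ V) (ξ : HTensor H K) : ξ ∈ V := by
  refine UniformSpace.Completion.induction_on (p := fun ξ : HTensor H K => ξ ∈ V) ξ hV fun a => ?_
  change HTensor.ofAlg H K a ∈ V
  induction a using TensorProduct.induction_on with
  | zero => rw [map_zero]; exact V.zero_mem
  | tmul a b => exact h a b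
  | add a b ha hb => rw [map_add]; exact V.add_mem ha hb

theorem htensor_ext {S T : HTensor H K →L[ℂ] HTensor H K}
    (h : ∀ a b, S (tmulL H K a b) = T (tmulL H K a b)) : S = T := by
  ext ξ
  exact htensor_induction (V := LinearMap.eqLocus S.toLinearMap T.toLinearMap)
    (isClosed_eq S.continuous T.continuous) h ξ

/-- The operator `x ⊗ y` on the Hilbert space tensor product. -/
def opTensor (x : H →L[ℂ] H) (y : K →L[ℂ] K) : HTensor H K →L[ℂ] HTensor H K :=
  (TensorProduct.mapL x y).completion

@[simp]
theorem opTensor_tmulL (x : H →L[ℂ] H) (y : K →L[ℂ] K) (h : H) (k : K) :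
    opTensor x y (tmulL H K h k) = tmulL H K (x h) (y k) := by
  exact ContinuousLinearMap.completion_apply_coe (TensorProduct.mapL x y) (h ⊗ₜ[ℂ] k)

theorem norm_opTensor_le (x : H →L[ℂ] H) (y : K →L[ℂ] K) : ‖opTensor x y‖ ≤ ‖x‖ * ‖y‖ := by
  refine ContinuousLinearMap.opNorm_le_bound _ (by positivity) fun ξ => ?_
  refine UniformSpace.Completion.induction_on
    (p := fun ξ : HTensor H K => ‖opTensor x y ξ‖ ≤ ‖x‖ * ‖y‖ * ‖ξ‖) ξ
    (isClosed_le (opTensor x y).continuous.norm (continuous_const.mul continuous_norm)) fun a => ?_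
  have e : opTensor x y (HTensor.ofAlg H K a) = HTensor.ofAlg H K (TensorProduct.mapL x y a) :=
    ContinuousLinearMap.completion_apply_coe (TensorProduct.mapL x y) a
  have n : ∀ b, ‖HTensor.ofAlg H K b‖ = ‖b‖ := fun b => UniformSpace.Completion.norm_coe b
  change ‖opTensor x y (HTensor.ofAlg H K a)‖ ≤ _ * ‖HTensor.ofAlg H K a‖
  rw [e, n, n]
  exact (ContinuousLinearMap.le_opNorm _ _).trans
    (mul_le_mul_of_nonneg_right (TensorProduct.norm_mapL_le x y) (norm_nonneg a))

theorem star_opTensor (x : H →L[ℂ] H) (y : K →L[ℂ] K) :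
    star (opTensor x y) = opTensor (star x) (star y) := by
  refine htensor_ext fun a b => ext_inner_right ℂ fun ξ => ?_
  let V : Submodule ℂ (HTensor H K) := LinearMap.eqLocus
    (innerSL ℂ (star (opTensor x y) (tmulL H K a b))).toLinearMap
    (innerSL ℂ (opTensor (star x) (star y) (tmulL H K a b))).toLinearMap
  refine htensor_induction (V := V)
    (isClosed_eq (ContinuousLinearMap.continuous _) (ContinuousLinearMap.continuous _))
    (fun h k => ?_) ξ
  change ⟪star (opTensor x y) (tmulL H K a b), tmulL H K h k⟫_ℂ
    = ⟪opTensor (star x) (star y) (tmulL H K a b), tmulL H K h k⟫_ℂ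
  rw [ContinuousLinearMap.star_eq_adjoint, ContinuousLinearMap.adjoint_inner_left]
  simp [inner_tmulL, ContinuousLinearMap.star_eq_adjoint, ContinuousLinearMap.adjoint_inner_left]

theorem opTensor_mul (x x' : H →L[ℂ] H) (y y' : K →L[ℂ] K) :
    opTensor x y * opTensor x' y' = opTensor (x * x') (y * y') :=
  htensor_ext fun a b => by simp

theorem opTensor_one : opTensor (1 : H →L[ℂ] H) (1 : K →L[ℂ] K) = 1 :=
  htensor_ext fun a b => by simp

/-- The von Neumann algebra tensor product `N ⊗ M`, generated by the operators `x ⊗ y`. -/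
def vnTensor (N : VonNeumannAlgebra H) (M : VonNeumannAlgebra K) :
    VonNeumannAlgebra (HTensor H K) :=
  vnGen {z | ∃ x ∈ N, ∃ y ∈ M, z = opTensor x y}

variable {N : VonNeumannAlgebra H} {M : VonNeumannAlgebra K}

/-- The element `x ⊗ y` of `N ⊗ M`. -/
def tmulEl (x : El N) (y : El M) : El (vnTensor N M) :=
  El.mk (opTensor x.op y.op) (subset_vnGen _ ⟨x.op, x.op_mem, y.op, y.op_mem, rfl⟩)

@[simp]
theorem op_tmulEl (x : El N) (y : El M) :
    (tmulEl x y).op = opTensor x.op y.op := rfl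

theorem tmulEl_mul (x x' : El N) (y y' : El M) :
    tmulEl x y * tmulEl x' y' = tmulEl (x * x') (y * y') :=
  El.ext (opTensor_mul _ _ _ _)

theorem tmulEl_one : tmulEl (1 : El N) (1 : El M) = 1 := El.ext opTensor_one

variable (N M) in
/-- The map `x ↦ x ⊗ 1`. -/
def inclLeft : El N →L[ℂ] El (vnTensor N M) :=
  LinearMap.mkContinuous
    { toFun := fun x => tmulEl x 1
      map_add' := fun x y => El.ext (htensor_ext fun a b => by simp)
      map_smul' := fun c x => El.ext (htensor_ext fun a b => by simp) }
    ‖(1 : K →L[ℂ] K)‖ fun x => by rw [mul_comm]; exact norm_opTensor_le _ _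

variable (N M) in
/-- The map `y ↦ 1 ⊗ y`. -/
def inclRight : El M →L[ℂ] El (vnTensor N M) :=
  LinearMap.mkContinuous
    { toFun := fun y => tmulEl 1 y
      map_add' := fun x y => El.ext (htensor_ext fun a b => by simp)
      map_smul' := fun c x => El.ext (htensor_ext fun a b => by simp) }
    ‖(1 : H →L[ℂ] H)‖ fun x => norm_opTensor_le _ _

@[simp]
theorem inclLeft_apply (x : El N) : inclLeft N M x = tmulEl x 1 := rfl

@[simp]
theorem inclRight_apply (y : El M) : inclRight N M y = tmulEl 1 y := rfl

/-! #### Slice maps -/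

/-- The compression `B(h)* x B(h')` of an operator along a bilinear map `B`. -/
def compress (B : H →L[ℂ] K →L[ℂ] L) (h h' : H) (x : L →L[ℂ] L) : K →L[ℂ] K :=
  (B h).adjoint ∘L x ∘L B h'

theorem inner_compress (B : H →L[ℂ] K →L[ℂ] L) (h h' : H) (x : L →L[ℂ] L) (k k' : K) :
    ⟪k, compress B h h' x k'⟫_ℂ = ⟪B h k, x (B h' k')⟫_ℂ := by
  simp [compress, ContinuousLinearMap.adjoint_inner_right]

theorem norm_compress_le (B : H →L[ℂ] K →L[ℂ] L) (h h' : H) (x : L →L[ℂ] L) :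
    ‖compress B h h' x‖ ≤ ‖B‖ * ‖h‖ * (‖x‖ * (‖B‖ * ‖h'‖)) := by
  refine (ContinuousLinearMap.opNorm_comp_le _ _).trans ?_
  rw [LinearIsometryEquiv.norm_map]
  refine mul_le_mul (B.le_opNorm h) ?_ (norm_nonneg _) (by positivity)
  refine (ContinuousLinearMap.opNorm_comp_le _ _).trans ?_
  exact mul_le_mul_of_nonneg_left (B.le_opNorm h') (norm_nonneg x)

/-- All compressions of elements of `A` along `B` lie in `M`. -/
def Compressible (B : H →L[ℂ] K →L[ℂ] L) (A : VonNeumannAlgebra L) (M : VonNeumannAlgebra K) :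
    Prop :=
  ∀ h h', ∀ x ∈ A, compress B h h' x ∈ M

variable {B : H →L[ℂ] K →L[ℂ] L} {A : VonNeumannAlgebra L}

/-- The compression as a map `A → M`. -/
def compressEl (hB : Compressible B A M) (h h' : H) : El A →L[ℂ] El M :=
  LinearMap.mkContinuous
    { toFun := fun x => El.mk (compress B h h' x.op) (hB h h' x.op x.op_mem)
      map_add' := fun x y => El.ext (by ext; simp [compress])
      map_smul' := fun c x => El.ext (by ext; simp [compress]) }
    (‖B‖ * ‖h‖ * (‖B‖ * ‖h'‖)) fun x => by
      refine (norm_compress_le B h h' x.op).trans (le_of_eq ?_)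
      rw [El.norm_op]
      ring

@[simp]
theorem op_compressEl (hB : Compressible B A M) (h h' : H) (x : El A) :
    (compressEl hB h h' x).op = compress B h h' x.op := rfl

theorem norm_compressEl_apply_le (hB : Compressible B A M) (h h' : H) (x : El A) :
    ‖compressEl hB h h' x‖ ≤ ‖B‖ * ‖h‖ * (‖x‖ * (‖B‖ * ‖h'‖)) :=
  norm_compress_le B h h' x.op

/-- Compressions are normal. -/
theorem compressEl_normal (hB : Compressible B A M) (h h' : H) (k k' : K) :
    vecFunctional M k k' ∘L compressEl hB h h' ∈ predual A := by
  convert vecFunctional_mem A (B h k) (B h' k') using 1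
  ext x
  exact inner_compress B h h' x.op k k'

/-- The sesquilinear form `(h, h') ↦ ψ (B(h)* x B(h'))`. -/
def sliceForm (hB : Compressible B A M) (ψ : StrongDual ℂ (El M)) (x : El A) :
    H →L⋆[ℂ] H →L[ℂ] ℂ :=
  LinearMap.mkContinuous₂
    (LinearMap.mk₂'ₛₗ (starRingEnd ℂ) (RingHom.id ℂ) (fun h h' => ψ (compressEl hB h h' x))
      (fun h₁ h₂ h' => by
        rw [← map_add]; congr 1; exact El.ext (by ext; simp [compress]))
      (fun c h h' => by
        rw [← map_smul]; congr 1; exact El.ext (by ext; simp [compress, map_smulₛₗ]))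
      (fun h h₁ h₂ => by
        rw [← map_add]; congr 1; exact El.ext (by ext; simp [compress]))
      (fun c h h' => by
        rw [← map_smul]; congr 1; exact El.ext (by ext; simp [compress])))
    (‖ψ‖ * (‖B‖ * ‖x‖ * ‖B‖)) (fun h h' => by
      refine (ψ.le_opNorm _).trans ?_
      refine (mul_le_mul_of_nonneg_left (norm_compressEl_apply_le hB h h' x)
        (norm_nonneg ψ)).trans (le_of_eq ?_)
      ring)

/-- The slice `S` of `x` by `ψ`: the operator on `H` with `⟨h, S h'⟩ = ψ (B(h)* x B(h'))`. -/
def slice (hB : Compressible B A M) (ψ : StrongDual ℂ (El M)) (x : El A) : H →L[ℂ] H :=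
  (InnerProductSpace.continuousLinearMapOfBilin (sliceForm hB ψ x)).adjoint

theorem inner_slice (hB : Compressible B A M) (ψ : StrongDual ℂ (El M)) (x : El A) (h h' : H) :
    ⟪h, slice hB ψ x h'⟫_ℂ = ψ (compressEl hB h h' x) := by
  rw [slice, ContinuousLinearMap.adjoint_inner_right,
    InnerProductSpace.continuousLinearMapOfBilin_apply]
  rfl

theorem op_ext_inner {S T : H →L[ℂ] H} (h : ∀ a b, ⟪a, S b⟫_ℂ = ⟪a, T b⟫_ℂ) : S = T := by
  ext b
  exact ext_inner_left ℂ fun a => h a b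

theorem norm_slice_le (hB : Compressible B A M) (ψ : StrongDual ℂ (El M)) (x : El A) :
    ‖slice hB ψ x‖ ≤ ‖ψ‖ * (‖B‖ * ‖x‖ * ‖B‖) := by
  refine ContinuousLinearMap.opNorm_le_bound _ (by positivity) fun b => ?_
  have h1 : ‖slice hB ψ x b‖ * ‖slice hB ψ x b‖
      ≤ ‖slice hB ψ x b‖ * (‖ψ‖ * (‖B‖ * ‖x‖ * ‖B‖) * ‖b‖) := by
    calc ‖slice hB ψ x b‖ * ‖slice hB ψ x b‖
        = ‖⟪slice hB ψ x b, slice hB ψ x b⟫_ℂ‖ := by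
          rw [inner_self_eq_norm_sq_to_K]; simp [pow_two]
      _ = ‖ψ (compressEl hB (slice hB ψ x b) b x)‖ := by rw [inner_slice]
      _ ≤ ‖ψ‖ * (‖B‖ * ‖slice hB ψ x b‖ * (‖x‖ * (‖B‖ * ‖b‖))) :=
        (ψ.le_opNorm _).trans
          (mul_le_mul_of_nonneg_left (norm_compressEl_apply_le hB _ b x) (norm_nonneg ψ))
      _ = _ := by ring
  rcases (norm_nonneg (slice hB ψ x b)).eq_or_lt with h0 | hpos
  · rw [← h0]; positivity
  · exact le_of_mul_le_mul_left h1 hpos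

/-- If all slices of elements of `A` lie in `N`, the slice map `A → N`. -/
def sliceL (hB : Compressible B A M) (N : VonNeumannAlgebra H) (ψ : StrongDual ℂ (El M))
    (hN : ∀ x, slice hB ψ x ∈ N) : El A →L[ℂ] El N :=
  LinearMap.mkContinuous
    { toFun := fun x => El.mk (slice hB ψ x) (hN x)
      map_add' := fun x y => El.ext (op_ext_inner fun a b => by
        simp [inner_slice])
      map_smul' := fun c x => El.ext (op_ext_inner fun a b => by
        simp [inner_slice]) }
    (‖ψ‖ * (‖B‖ * ‖B‖)) fun x => by
      refine (norm_slice_le hB ψ x).trans (le_of_eq ?_)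
      ring

@[simp]
theorem op_sliceL (hB : Compressible B A M) (ψ : StrongDual ℂ (El M))
    (hN : ∀ x, slice hB ψ x ∈ N) (x : El A) :
    (sliceL hB N ψ hN x).op = slice hB ψ x := rfl

/-- Slicing with a normal functional is normal. -/
theorem sliceL_normal (hB : Compressible B A M) (ψ : Predual M)
    (hN : ∀ x, slice hB ψ.toDual x ∈ N) (h h' : H) :
    vecFunctional N h h' ∘L sliceL hB N ψ.toDual hN ∈ predual A := by
  convert (predualMap (compressEl hB h h') (compressEl_normal hB h h') ψ).toDual_mem using 1
  ext x
  exact inner_slice hB ψ.toDual x h h'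

theorem slice_mul_right (hB : Compressible B A M) (ψ : StrongDual ℂ (El M)) (x y : El A)
    (n : H →L[ℂ] H) (hy : ∀ h k, y.op (B h k) = B (n h) k) :
    slice hB ψ (x * y) = slice hB ψ x * n := by
  refine op_ext_inner fun a b => ?_
  rw [inner_slice, mul_apply_eq_comp, inner_slice]
  congr 1
  refine El.ext (op_ext_inner fun k k' => ?_)
  simp [inner_compress, hy]

theorem slice_mul_left (hB : Compressible B A M) (ψ : StrongDual ℂ (El M)) (x y : El A)
    (n : H →L[ℂ] H) (hy : ∀ h k, star y.op (B h k) = B (star n h) k) :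
    slice hB ψ (y * x) = n * slice hB ψ x := by
  refine op_ext_inner fun a b => ?_
  rw [inner_slice, mul_apply_eq_comp, ← ContinuousLinearMap.adjoint_inner_left,
    inner_slice]
  congr 1
  refine El.ext (op_ext_inner fun k k' => ?_)
  have := hy a k
  rw [ContinuousLinearMap.star_eq_adjoint, ContinuousLinearMap.star_eq_adjoint] at this
  simp [inner_compress, ← this, ContinuousLinearMap.adjoint_inner_left]

end Tensor

/-! ### Slice maps, product functionals and conditional expectations on `N ⊗ M` -/

section Product

variable {H K : Type*} [NormedAddCommGroup H] [InnerProductSpace ℂ H] [CompleteSpace H]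
  [NormedAddCommGroup K] [InnerProductSpace ℂ K] [CompleteSpace K]
  {N : VonNeumannAlgebra H} {M : VonNeumannAlgebra K}

theorem mem_vn_iff {x : H →L[ℂ] H} : x ∈ N ↔ ∀ z ∈ N.commutant, z * x = x * z := by
  rw [← VonNeumannAlgebra.mem_commutant_iff, VonNeumannAlgebra.commutant_commutant]

theorem commute_tensor_left {z : H →L[ℂ] H} (hz : z ∈ N.commutant) {x : HTensor H K →L[ℂ] HTensor H K}
    (hx : x ∈ vnTensor N M) : opTensor z 1 * x = x * opTensor z 1 := by
  have h1 := VonNeumannAlgebra.mem_commutant_iff.1 hz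
  have h2 := VonNeumannAlgebra.mem_commutant_iff.1 (star_mem hz)
  refine commute_of_mem_vnGen hx ?_ ?_
  · rintro _ ⟨a, ha, b, hb, rfl⟩
    rw [opTensor_mul, opTensor_mul, h1 a ha, one_mul, mul_one]
  · rintro _ ⟨a, ha, b, hb, rfl⟩
    rw [star_opTensor, star_one, opTensor_mul, opTensor_mul, h2 a ha, one_mul, mul_one]

theorem commute_tensor_right {z : K →L[ℂ] K} (hz : z ∈ M.commutant)
    {x : HTensor H K →L[ℂ] HTensor H K}
    (hx : x ∈ vnTensor N M) : opTensor 1 z * x = x * opTensor 1 z := by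
  have h1 := VonNeumannAlgebra.mem_commutant_iff.1 hz
  have h2 := VonNeumannAlgebra.mem_commutant_iff.1 (star_mem hz)
  refine commute_of_mem_vnGen hx ?_ ?_
  · rintro _ ⟨a, ha, b, hb, rfl⟩
    rw [opTensor_mul, opTensor_mul, h1 b hb, one_mul, mul_one]
  · rintro _ ⟨a, ha, b, hb, rfl⟩
    rw [star_opTensor, star_one, opTensor_mul, opTensor_mul, h2 b hb, one_mul, mul_one]

theorem inner_op_left {L : Type*} [NormedAddCommGroup L] [InnerProductSpace ℂ L] [CompleteSpace L]
    (z : L →L[ℂ] L) (a b : L) : ⟪a, z b⟫_ℂ = ⟪star z a, b⟫_ℂ := by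
  rw [ContinuousLinearMap.star_eq_adjoint, ContinuousLinearMap.adjoint_inner_left]

theorem compressible_right : Compressible (tmulL H K) (vnTensor N M) M := by
  intro h h' x hx
  rw [mem_vn_iff]
  intro z hz
  refine op_ext_inner fun k k' => ?_
  rw [mul_apply_eq_comp, mul_apply_eq_comp, inner_op_left, inner_compress, inner_compress]
  have h1 : tmulL H K h (star z k) = star (opTensor 1 z) (tmulL H K h k) := by
    simp [star_opTensor]
  have h2 : tmulL H K h' (z k') = opTensor 1 z (tmulL H K h' k') := by simp
  rw [h1, h2, ← inner_op_left, ← mul_apply_eq_comp, ← mul_apply_eq_comp, commute_tensor_right hz hx]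

theorem compressible_left : Compressible (tmulL H K).flip (vnTensor N M) N := by
  intro k k' x hx
  rw [mem_vn_iff]
  intro z hz
  refine op_ext_inner fun h h' => ?_
  rw [mul_apply_eq_comp, mul_apply_eq_comp, inner_op_left, inner_compress, inner_compress]
  have h1 : (tmulL H K).flip k (star z h) = star (opTensor z 1) ((tmulL H K).flip k h) := by
    simp [star_opTensor]
  have h2 : (tmulL H K).flip k' (z h') = opTensor z 1 ((tmulL H K).flip k' h') := by simp
  rw [h1, h2, ← inner_op_left, ← mul_apply_eq_comp, ← mul_apply_eq_comp, commute_tensor_left hz hx]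

theorem slice_mem_left (ψ : StrongDual ℂ (El M)) (x : El (vnTensor N M)) :
    slice compressible_right ψ x ∈ N := by
  rw [mem_vn_iff]
  intro z hz
  refine op_ext_inner fun h h' => ?_
  rw [mul_apply_eq_comp, mul_apply_eq_comp, inner_op_left, inner_slice, inner_slice]
  congr 1
  refine El.ext (op_ext_inner fun k k' => ?_)
  rw [op_compressEl, op_compressEl, inner_compress, inner_compress]
  have h1 : tmulL H K (star z h) k = star (opTensor z 1) (tmulL H K h k) := by
    simp [star_opTensor]
  have h2 : tmulL H K (z h') k' = opTensor z 1 (tmulL H K h' k') := by simp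
  rw [h1, h2, ← inner_op_left, ← mul_apply_eq_comp, ← mul_apply_eq_comp, commute_tensor_left hz x.op_mem]

theorem slice_mem_right (φ : StrongDual ℂ (El N)) (x : El (vnTensor N M)) :
    slice compressible_left φ x ∈ M := by
  rw [mem_vn_iff]
  intro z hz
  refine op_ext_inner fun k k' => ?_
  rw [mul_apply_eq_comp, mul_apply_eq_comp, inner_op_left, inner_slice, inner_slice]
  congr 1
  refine El.ext (op_ext_inner fun h h' => ?_)
  rw [op_compressEl, op_compressEl, inner_compress, inner_compress]
  have h1 : (tmulL H K).flip (star z k) h = star (opTensor 1 z) ((tmulL H K).flip k h) := by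
    simp [star_opTensor]
  have h2 : (tmulL H K).flip (z k') h' = opTensor 1 z ((tmulL H K).flip k' h') := by simp
  rw [h1, h2, ← inner_op_left, ← mul_apply_eq_comp, ← mul_apply_eq_comp, commute_tensor_right hz x.op_mem]

variable (N) in
/-- The slice map `ι ⊗ ψ : N ⊗ M → N`. -/
def sliceToLeft (ψ : StrongDual ℂ (El M)) : El (vnTensor N M) →L[ℂ] El N :=
  sliceL compressible_right N ψ (slice_mem_left ψ)

variable (M) in
/-- The slice map `φ ⊗ ι : N ⊗ M → M`. -/
def sliceToRight (φ : StrongDual ℂ (El N)) : El (vnTensor N M) →L[ℂ] El M :=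
  sliceL compressible_left M φ (slice_mem_right φ)

/-- The product functional `φ ⊗ ψ` on `N ⊗ M`, defined as `φ ∘ (ι ⊗ ψ)`. -/
def prodFunctional (φ : Predual N) (ψ : Predual M) : Predual (vnTensor N M) :=
  predualMap (sliceToLeft N ψ.toDual)
    (sliceL_normal compressible_right ψ (slice_mem_left _)) φ

theorem prodFunctional_apply (φ : Predual N) (ψ : Predual M) (x : El (vnTensor N M)) :
    prodFunctional φ ψ x
      = φ (sliceToLeft N ψ.toDual x) := rfl

theorem sliceToLeft_tmul (ψ : StrongDual ℂ (El M)) (x : El N) (y : El M) :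
    sliceToLeft N ψ (tmulEl x y) = ψ y • x := by
  refine El.ext (op_ext_inner fun h h' => ?_)
  have e : compressEl (compressible_right (N := N) (M := M)) h h' (tmulEl x y)
      = ⟪h, x.op h'⟫_ℂ • y := by
    refine El.ext (op_ext_inner fun k k' => ?_)
    simp [inner_compress, inner_tmulL]
  change ⟪h, slice compressible_right ψ (tmulEl x y) h'⟫_ℂ = _
  rw [inner_slice, e]
  simp [mul_comm]

theorem sliceToRight_tmul (φ : StrongDual ℂ (El N)) (x : El N) (y : El M) :
    sliceToRight M φ (tmulEl x y) = φ x • y := by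
  refine El.ext (op_ext_inner fun k k' => ?_)
  have e : compressEl (compressible_left (N := N) (M := M)) k k' (tmulEl x y)
      = ⟪k, y.op k'⟫_ℂ • x := by
    refine El.ext (op_ext_inner fun h h' => ?_)
    simp [inner_compress, inner_tmulL, mul_comm]
  change ⟪k, slice compressible_left φ (tmulEl x y) k'⟫_ℂ = _
  rw [inner_slice, e]
  simp [mul_comm]

/-- `(φ ⊗ ψ)(x ⊗ y) = φ(x) ψ(y)`, which determines the normal functional `φ ⊗ ψ`. -/
theorem prodFunctional_tmul (φ : Predual N) (ψ : Predual M) (x : El N) (y : El M) :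
    prodFunctional φ ψ (tmulEl x y)
      = φ x * ψ y := by
  rw [prodFunctional_apply, sliceToLeft_tmul, map_smul, smul_eq_mul, mul_comm]

/-- `φ ⊗ ψ` is also `ψ ∘ (φ ⊗ ι)`. -/
theorem prodFunctional_apply' (φ : Predual N) (ψ : Predual M) (x : El (vnTensor N M)) :
    prodFunctional φ ψ x
      = ψ (sliceToRight M φ.toDual x) := by
  let T : StrongDual ℂ (El N) →L[ℂ] El M := LinearMap.mkContinuous
    { toFun := fun φ => sliceToRight M φ x
      map_add' := fun φ φ' => El.ext (op_ext_inner fun a b => by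
        simp [sliceToRight, inner_slice])
      map_smul' := fun c φ => El.ext (op_ext_inner fun a b => by
        simp [sliceToRight, inner_slice]) }
    (‖(tmulL H K).flip‖ * ‖x‖ * ‖(tmulL H K).flip‖) fun φ => by
      rw [mul_comm]
      exact norm_slice_le compressible_left φ x
  let ψ' : StrongDual ℂ (El M) := ψ.toDual
  let f₁ : StrongDual ℂ (El N) →L[ℂ] ℂ :=
    ContinuousLinearMap.apply ℂ ℂ (sliceToLeft N ψ' x)
  let f₂ : StrongDual ℂ (El N) →L[ℂ] ℂ := ψ' ∘L T
  refine predual_induction (V := LinearMap.eqLocus f₁.toLinearMap f₂.toLinearMap)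
    (isClosed_eq f₁.continuous f₂.continuous) (fun h h' => ?_) φ.toDual_mem
  change vecFunctional N h h' (sliceToLeft N ψ' x) = ψ' (sliceToRight M (vecFunctional N h h') x)
  refine (inner_slice compressible_right ψ' x h h').trans ?_
  congr 1
  refine El.ext (op_ext_inner fun k k' => ?_)
  refine (inner_compress _ _ _ _ _ _).trans ?_
  refine Eq.trans ?_ (inner_slice compressible_left _ x k k').symm
  refine Eq.trans ?_ (inner_compress (tmulL H K).flip k k' x.op h h').symm
  rfl

theorem normal_of_tmul {L : Type*} [NormedAddCommGroup L] [InnerProductSpace ℂ L] [CompleteSpace L]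
    {A : VonNeumannAlgebra L} (R : El A →L[ℂ] El (vnTensor N M))
    (hR : ∀ h k h' k', vecFunctional (vnTensor N M) (tmulL H K h k) (tmulL H K h' k') ∘L R
      ∈ predual A) (ξ η : HTensor H K) :
    vecFunctional (vnTensor N M) ξ η ∘L R ∈ predual A := by
  have step : ∀ h' k', vecFunctional (vnTensor N M) ξ (tmulL H K h' k') ∘L R ∈ predual A := by
    intro h' k'
    let V : Submodule ℂ (HTensor H K) :=
      { carrier := {a | vecFunctional (vnTensor N M) a (tmulL H K h' k') ∘L R ∈ predual A}
        zero_mem' := by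
          change _ ∈ predual A
          convert (predual A).zero_mem using 1
          ext x; simp
        add_mem' := fun {a b} ha hb => by
          change _ ∈ predual A
          convert (predual A).add_mem ha hb using 1
          ext x; simp
        smul_mem' := fun c a ha => by
          change _ ∈ predual A
          convert (predual A).smul_mem (starRingEnd ℂ c) ha using 1
          ext x; simp [mul_comm] }
    refine htensor_induction (V := V) ?_ (fun h k => hR h k h' k') ξ
    refine (predual_isClosed A).preimage ?_
    unfold vecFunctional
    exact ((innerSL ℂ).continuous.clm_comp continuous_const).clm_comp continuous_const
  let V : Submodule ℂ (HTensor H K) :=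
    { carrier := {b | vecFunctional (vnTensor N M) ξ b ∘L R ∈ predual A}
      zero_mem' := by
        change _ ∈ predual A
        convert (predual A).zero_mem using 1
        ext x; simp
      add_mem' := fun {a b} ha hb => by
        change _ ∈ predual A
        convert (predual A).add_mem ha hb using 1
        ext x; simp
      smul_mem' := fun c a ha => by
        change _ ∈ predual A
        convert (predual A).smul_mem c ha using 1
        ext x; simp }
  refine htensor_induction (V := V) ?_ step η
  refine (predual_isClosed A).preimage ?_
  unfold vecFunctional
  exact (continuous_const.clm_comp
    ((ContinuousLinearMap.apply ℂ (HTensor H K)).continuous.clm_comp continuous_const)).clm_comp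
      continuous_const

/-- `x ↦ x ⊗ 1` is normal. -/
theorem inclLeft_normal (ξ η : HTensor H K) :
    vecFunctional (vnTensor N M) ξ η ∘L inclLeft N M ∈ predual N := by
  refine normal_of_tmul _ (fun h k h' k' => ?_) ξ η
  convert (predual N).smul_mem ⟪k, k'⟫_ℂ (vecFunctional_mem N h h') using 1
  ext x
  simp [inner_tmulL, mul_comm]

/-- `y ↦ 1 ⊗ y` is normal. -/
theorem inclRight_normal (ξ η : HTensor H K) :
    vecFunctional (vnTensor N M) ξ η ∘L inclRight N M ∈ predual M := by
  refine normal_of_tmul _ (fun h k h' k' => ?_) ξ η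
  convert (predual M).smul_mem ⟪h, h'⟫_ℂ (vecFunctional_mem M k k') using 1
  ext x
  simp [inner_tmulL]

variable (N) in
/-- The conditional expectation `E_N : N ⊗ M → N ⊗ 1`, `E_N(x) = (ι ⊗ ψ)(x) ⊗ 1`. For states `φ`
and `ψ` it preserves `φ ⊗ ψ`. -/
def condExpLeft (ψ : Predual M) : El (vnTensor N M) →L[ℂ] El (vnTensor N M) :=
  inclLeft N M ∘L sliceToLeft N ψ.toDual

variable (M) in
/-- The conditional expectation `E_M : N ⊗ M → 1 ⊗ M`, `E_M(x) = 1 ⊗ (φ ⊗ ι)(x)`. For states `φ`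
and `ψ` it preserves `φ ⊗ ψ`. -/
def condExpRight (φ : Predual N) : El (vnTensor N M) →L[ℂ] El (vnTensor N M) :=
  inclRight N M ∘L sliceToRight M φ.toDual

variable (N) in
/-- The map `ω ↦ ω|_{N ⊗ 1} ∘ E_N` on the predual. -/
def condExpLeftPredual (ψ : Predual M) : Predual (vnTensor N M) →L[ℂ] Predual (vnTensor N M) :=
  predualMap (condExpLeft N ψ) fun ξ η =>
    (predualMap (sliceToLeft N ψ.toDual)
      (sliceL_normal compressible_right ψ (slice_mem_left _))
      ⟨vecFunctional (vnTensor N M) ξ η ∘L inclLeft N M, inclLeft_normal ξ η⟩).toDual_mem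

variable (M) in
/-- The map `ω ↦ ω|_{1 ⊗ M} ∘ E_M` on the predual. -/
def condExpRightPredual (φ : Predual N) : Predual (vnTensor N M) →L[ℂ] Predual (vnTensor N M) :=
  predualMap (condExpRight M φ) fun ξ η =>
    (predualMap (sliceToRight M φ.toDual)
      (sliceL_normal compressible_left φ (slice_mem_right _))
      ⟨vecFunctional (vnTensor N M) ξ η ∘L inclRight N M, inclRight_normal ξ η⟩).toDual_mem

end Product

/-! ### The projections `F_{N,j}^p` and `F_{M,i}^p` -/

section Projections

variable {H K : Type*} [NormedAddCommGroup H] [InnerProductSpace ℂ H] [CompleteSpace H]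
  [NormedAddCommGroup K] [InnerProductSpace ℂ K] [CompleteSpace K]
  {N : VonNeumannAlgebra H} {M : VonNeumannAlgebra K}

theorem sliceToLeft_mul_right (ψ : StrongDual ℂ (El M)) (x : El (vnTensor N M)) (n : El N) :
    sliceToLeft N ψ (x * tmulEl n 1) = sliceToLeft N ψ x * n :=
  El.ext (slice_mul_right compressible_right ψ x (tmulEl n 1) n.op fun h k => by simp)

theorem sliceToLeft_mul_left (ψ : StrongDual ℂ (El M)) (x : El (vnTensor N M)) (n : El N) :
    sliceToLeft N ψ (tmulEl n 1 * x) = n * sliceToLeft N ψ x :=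
  El.ext (slice_mul_left compressible_right ψ x (tmulEl n 1) n.op fun h k => by
    simp [star_opTensor])

theorem sliceToRight_mul_right (φ : StrongDual ℂ (El N)) (x : El (vnTensor N M)) (m : El M) :
    sliceToRight M φ (x * tmulEl 1 m) = sliceToRight M φ x * m :=
  El.ext (slice_mul_right compressible_left φ x (tmulEl 1 m) m.op fun k h => by simp)

theorem sliceToRight_mul_left (φ : StrongDual ℂ (El N)) (x : El (vnTensor N M)) (m : El M) :
    sliceToRight M φ (tmulEl 1 m * x) = m * sliceToRight M φ x :=
  El.ext (slice_mul_left compressible_left φ x (tmulEl 1 m) m.op fun k h => by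
    simp [star_opTensor])

/-- `E_N` preserves `φ ⊗ ψ`. -/
theorem prodFunctional_condExpLeft (φ : Predual N) (ψ : Predual M)
    (hψ : ψ 1 = 1) (x : El (vnTensor N M)) :
    prodFunctional φ ψ (condExpLeft N ψ x)
      = prodFunctional φ ψ x := by
  simp [prodFunctional_apply, condExpLeft, sliceToLeft_tmul, hψ]

/-- `E_M` preserves `φ ⊗ ψ`. -/
theorem prodFunctional_condExpRight (φ : Predual N) (ψ : Predual M)
    (hφ : φ 1 = 1) (x : El (vnTensor N M)) :
    prodFunctional φ ψ (condExpRight M φ x)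
      = prodFunctional φ ψ x := by
  simp [prodFunctional_apply', condExpRight, sliceToRight_tmul, hφ]

theorem lmul_compat (N : VonNeumannAlgebra H) (ω : Predual N) (a x : El N) :
    lmulPredual N a (leftInj N ω x) = leftInj N ω (lmul N a x) := by
  refine Predual.ext fun y => ?_
  simp [lmul, mul_assoc]

theorem condExpLeft_compat (φ : Predual N) (ψ : Predual M) (x : El (vnTensor N M)) :
    condExpLeftPredual N ψ (leftInj (vnTensor N M) (prodFunctional φ ψ) x)
      = leftInj (vnTensor N M) (prodFunctional φ ψ) (condExpLeft N ψ x) := by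
  refine Predual.ext fun y => ?_
  simp [condExpLeftPredual, condExpLeft, prodFunctional_apply, sliceToLeft_mul_left,
    sliceToLeft_mul_right]

theorem condExpRight_compat (φ : Predual N) (ψ : Predual M) (x : El (vnTensor N M)) :
    condExpRightPredual M φ (leftInj (vnTensor N M) (prodFunctional φ ψ) x)
      = leftInj (vnTensor N M) (prodFunctional φ ψ) (condExpRight M φ x) := by
  refine Predual.ext fun y => ?_
  simp [condExpRightPredual, condExpRight, prodFunctional_apply', sliceToRight_mul_left,
    sliceToRight_mul_right]

/-- Left multiplication on `L^p(N)`, interpolated between left multiplication on `N` and `N_*`. -/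
def lmulLp (N : VonNeumannAlgebra H) (ω : Predual N) (p : ℝ≥0∞) [Fact (1 ≤ p)] (a : El N) :
    Lp N ω p →L[ℂ] Lp N ω p :=
  Interp.map (A₀ := El N) (A₁ := Predual N) (B₀ := El N) (B₁ := Predual N)
    (ι := leftInj N ω) (κ := leftInj N ω) (lmul N a) (lmulPredual N a) (lmul_compat N ω a) (param p)

/-- The interpolated conditional expectation `E_N^p` on `L^p(N ⊗ M)`. -/
def condExpLeftLp (φ : Predual N) (ψ : Predual M) (p : ℝ≥0∞) [Fact (1 ≤ p)] :
    Lp (vnTensor N M) (prodFunctional φ ψ) p →L[ℂ] Lp (vnTensor N M) (prodFunctional φ ψ) p :=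
  Interp.map (A₀ := El (vnTensor N M)) (A₁ := Predual (vnTensor N M))
    (B₀ := El (vnTensor N M)) (B₁ := Predual (vnTensor N M))
    (ι := leftInj (vnTensor N M) (prodFunctional φ ψ))
    (κ := leftInj (vnTensor N M) (prodFunctional φ ψ))
    (condExpLeft N ψ) (condExpLeftPredual N ψ) (condExpLeft_compat φ ψ) (param p)

/-- The interpolated conditional expectation `E_M^p` on `L^p(N ⊗ M)`. -/
def condExpRightLp (φ : Predual N) (ψ : Predual M) (p : ℝ≥0∞) [Fact (1 ≤ p)] :
    Lp (vnTensor N M) (prodFunctional φ ψ) p →L[ℂ] Lp (vnTensor N M) (prodFunctional φ ψ) p :=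
  Interp.map (A₀ := El (vnTensor N M)) (A₁ := Predual (vnTensor N M))
    (B₀ := El (vnTensor N M)) (B₁ := Predual (vnTensor N M))
    (ι := leftInj (vnTensor N M) (prodFunctional φ ψ))
    (κ := leftInj (vnTensor N M) (prodFunctional φ ψ))
    (condExpRight M φ) (condExpRightPredual M φ) (condExpRight_compat φ ψ) (param p)

/-- `F_{N,j}^p`, the interpolation of `F_{N,j}(x) = (1 ⊗ v_j) E_N((1 ⊗ v_j*) x)`. -/
def projLeft (φ : Predual N) (ψ : Predual M) (p : ℝ≥0∞) [Fact (1 ≤ p)] (v : El M) :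
    Lp (vnTensor N M) (prodFunctional φ ψ) p →L[ℂ] Lp (vnTensor N M) (prodFunctional φ ψ) p :=
  lmulLp (vnTensor N M) (prodFunctional φ ψ) p (tmulEl 1 v) ∘L condExpLeftLp φ ψ p ∘L
    lmulLp (vnTensor N M) (prodFunctional φ ψ) p (tmulEl 1 (star v))

/-- `F_{M,i}^p`, the interpolation of `F_{M,i}(x) = (u_i ⊗ 1) E_M((u_i* ⊗ 1) x)`. -/
def projRight (φ : Predual N) (ψ : Predual M) (p : ℝ≥0∞) [Fact (1 ≤ p)] (u : El N) :
    Lp (vnTensor N M) (prodFunctional φ ψ) p →L[ℂ] Lp (vnTensor N M) (prodFunctional φ ψ) p :=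
  lmulLp (vnTensor N M) (prodFunctional φ ψ) p (tmulEl u 1) ∘L condExpRightLp φ ψ p ∘L
    lmulLp (vnTensor N M) (prodFunctional φ ψ) p (tmulEl (star u) 1)

end Projections

/-! ### Schauder decompositions and the shell enumeration -/

/-- A sequence of closed subspaces `V s` of `X` is a Schauder decomposition if every `x` is in a
unique way the sum of a convergent series `∑ y s` with `y s ∈ V s`. -/
structure IsSchauderDecomposition {X : Type*} [NormedAddCommGroup X] [NormedSpace ℂ X]
    (V : ℕ → Submodule ℂ X) : Prop where
  isClosed : ∀ s, IsClosed (V s : Set X)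
  existsUnique : ∀ x : X, ∃! y : ℕ → X, (∀ s, y s ∈ V s) ∧
    Tendsto (fun n => ∑ s ∈ Finset.range n, y s) atTop (𝓝 x)

/-- The shell enumeration of `ℕ × ℕ`. -/
def shell (i j : ℕ) : ℕ := if i ≤ j then j ^ 2 + i else (i + 1) ^ 2 - j - 1

theorem shell_bijective : Function.Bijective fun q : ℕ × ℕ => shell q.1 q.2 := by
  have key : ∀ l r l' r' : ℕ, r ≤ 2 * l → r' ≤ 2 * l' → l ^ 2 + r = l' ^ 2 + r' → l = l' := by
    intro l r l' r' h h' e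
    by_contra hne
    rcases Nat.lt_or_gt_of_ne hne with h1 | h1 <;> nlinarith
  have hlt : ∀ i j : ℕ, j < i → shell i j = i ^ 2 + (2 * i - j) := by
    intro i j h
    have h2 : (i + 1) ^ 2 = i ^ 2 + 2 * i + 1 := by ring
    rw [shell, if_neg (by omega)]
    omega
  have hle : ∀ i j : ℕ, i ≤ j → shell i j = j ^ 2 + i := fun i j h => if_pos h
  constructor
  · rintro ⟨i, j⟩ ⟨i', j'⟩ e
    change shell i j = shell i' j' at e
    rcases le_or_gt i j with h | h <;> rcases le_or_gt i' j' with h' | h'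
    · rw [hle _ _ h, hle _ _ h'] at e
      have := key _ _ _ _ (by omega) (by omega) e
      subst this
      simpa using e
    · rw [hle _ _ h, hlt _ _ h'] at e
      have := key _ _ _ _ (by omega) (by omega) e
      subst this
      omega
    · rw [hlt _ _ h, hle _ _ h'] at e
      have := key _ _ _ _ (by omega) (by omega) e
      subst this
      omega
    · rw [hlt _ _ h, hlt _ _ h'] at e
      have := key _ _ _ _ (by omega) (by omega) e
      subst this
      have : j = j' := by omega
      rw [this]
  · intro k
    have h1 := Nat.sqrt_le' k
    have h2 := Nat.lt_succ_sqrt' k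
    set l := Nat.sqrt k
    have h3 : l.succ ^ 2 = l ^ 2 + 2 * l + 1 := by rw [Nat.succ_eq_add_one]; ring
    rcases le_or_gt (k - l ^ 2) l with h | h
    · exact ⟨(k - l ^ 2, l), by simp only; rw [hle _ _ h]; omega⟩
    · refine ⟨(l, 2 * l - (k - l ^ 2)), ?_⟩
      simp only
      rw [hlt _ _ (by omega)]
      omega

end NCLp

end

/-!
`F_{N,j}` and `F_{M,i}` are commuting projections, and the product of the two is of rank one:
`F_{N,j} F_{M,i} x = x(u_i* ⊗ v_j*) • i^p(u_i ⊗ v_j)`, where `x` acts as a functional. So the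
vectors in question span the intersections of the subspaces of the two decompositions.

The summation of the convergent series with terms in the subspaces of a Schauder decomposition is
a bijection between Banach spaces, the series being normed by the supremum of their partial sums.
By the open mapping theorem its inverse is bounded, so the terms of the expansion of `x` and, in a
uniform way, their partial sums depend continuously on `x`. The terms of the expansion commute with
every operator that leaves the subspaces of the decomposition invariant. In particular the terms
`Q_j` and `R_i` of the expansions in the two decompositions commute.

The shell enumeration runs through the square `[0, l)²` first, so the sum of the first `l²` of the
vectors `R_i Q_j x` is `∑_{j<l} Q_j (∑_{i<l} R_i x)`, which tends to `x`. From this square to the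
next it runs up the column `j = l` and then back along the row `i = l`. Up to a partial sum
`∑_{i<r} R_i (Q_l x)` over the column or `∑_{j<r} Q_j (R_l x)` over the row, the sum is therefore
that over one of the two squares, and these partial sums are small because `Q_l x` and `R_l x` tend
to zero.
-/

noncomputable section

namespace NCLp

section Completeness

/-- Evaluation at a point, on `C₀(ℝ, E)`. -/
def evalC₀ (E : Type*) [NormedAddCommGroup E] [NormedSpace ℂ E] (t : ℝ) : C₀(ℝ, E) →L[ℂ] E :=
  LinearMap.mkContinuous
    { toFun := fun g => g t
      map_add' := fun _ _ => rfl
      map_smul' := fun _ _ => rfl }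
    1 fun g => by simpa using C₀_norm_apply_le g t

@[simp]
theorem evalC₀_apply {E : Type*} [NormedAddCommGroup E] [NormedSpace ℂ E] (t : ℝ) (g : C₀(ℝ, E)) :
    evalC₀ E t g = g t := rfl

variable {A₀ A₁ : Type*} [NormedAddCommGroup A₀] [NormedSpace ℂ A₀]
  [NormedAddCommGroup A₁] [NormedSpace ℂ A₁] {ι : A₀ →L[ℂ] A₁} {α : Type*}

theorem IsCalderon.sub {f f' : ℂ → A₁} {g g' : C₀(ℝ, A₀)} {h h' : C₀(ℝ, A₁)}
    (H : IsCalderon ι f g h) (H' : IsCalderon ι f' g' h') :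
    IsCalderon ι (f - f') (g - g') (h - h') := by
  simpa [sub_eq_add_neg] using H.add (H'.smul (-1))

theorem IsCalderon.sum {f : α → ℂ → A₁} {g : α → C₀(ℝ, A₀)} {h : α → C₀(ℝ, A₁)}
    (s : Finset α) (H : ∀ n ∈ s, IsCalderon ι (f n) (g n) (h n)) :
    IsCalderon ι (∑ n ∈ s, f n) (∑ n ∈ s, g n) (∑ n ∈ s, h n) := by
  induction s using Finset.cons_induction with
  | empty => simpa using IsCalderon.zero
  | cons a s ha ih =>
    simp only [Finset.sum_cons]
    exact (H a (Finset.mem_cons_self a s)).add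
      (ih fun n hn => H n (Finset.mem_cons_of_mem hn))

theorem IsCalderon.tsum [CompleteSpace A₀] [CompleteSpace A₁]
    {f : α → ℂ → A₁} {g : α → C₀(ℝ, A₀)} {h : α → C₀(ℝ, A₁)}
    (H : ∀ n, IsCalderon ι (f n) (g n) (h n)) (hs : Summable fun n => max ‖g n‖ ‖h n‖) :
    IsCalderon ι (fun z => ∑' n, f n z) (∑' n, g n) (∑' n, h n) := by
  have hg : Summable g := .of_norm_bounded hs fun n => le_max_left _ _
  have hh : Summable h := .of_norm_bounded hs fun n => le_max_right _ _
  have hu : Summable fun n => max 1 ‖ι‖ * max ‖g n‖ ‖h n‖ := hs.mul_left _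
  have hf : ∀ n, ∀ z ∈ Complex.re ⁻¹' Icc 0 1, ‖f n z‖ ≤ max 1 ‖ι‖ * max ‖g n‖ ‖h n‖ :=
    fun n z hz => (H n).norm_le hz
  refine ⟨continuousOn_tsum (fun n => (H n).continuousOn) hu hf,
    ⟨_, fun z hz => tsum_of_norm_bounded hu.hasSum fun n => hf n z hz⟩,
    Complex.differentiableOn_tsum_of_summable_norm hu (fun n => (H n).differentiableOn)
      (isOpen_Ioo.preimage Complex.continuous_re) fun n z hz => hf n z ⟨hz.1.le, hz.2.le⟩,
    fun t => ?_, fun t => ?_⟩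
  · simpa [(H _).left_eq] using (hg.hasSum.mapL (ι ∘L evalC₀ A₀ t)).tsum_eq
  · simpa [(H _).right_eq] using (hh.hasSum.mapL (evalC₀ A₁ t)).tsum_eq

namespace Interp

variable [CompleteSpace A₀] [CompleteSpace A₁] {θ : unitInterval}

theorem exists_hasSum_of_isCalderon {a : α → Interp ι θ} {f : α → ℂ → A₁}
    {g : α → C₀(ℝ, A₀)} {h : α → C₀(ℝ, A₁)} (H : ∀ n, IsCalderon ι (f n) (g n) (h n))
    (hs : Summable fun n => max ‖g n‖ ‖h n‖) (ha : ∀ n, f n ((θ : ℝ) : ℂ) = val ι θ (a n)) :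
    ∃ b, HasSum a b := by
  have hg : Summable g := .of_norm_bounded hs fun n => le_max_left _ _
  have hh : Summable h := .of_norm_bounded hs fun n => le_max_right _ _
  let b : Interp ι θ := ⟨_, _, _, _, IsCalderon.tsum H hs, rfl⟩
  have hb : val ι θ b = ∑' n, f n ((θ : ℝ) : ℂ) := rfl
  refine ⟨b, tendsto_iff_norm_sub_tendsto_zero.2 ?_⟩
  have hbound : ∀ s : Finset α,
      ‖∑ n ∈ s, a n - b‖ ≤ max ‖∑ n ∈ s, g n - ∑' n, g n‖ ‖∑ n ∈ s, h n - ∑' n, h n‖ :=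
    fun s => norm_le_of ((IsCalderon.sum s fun n _ => H n).sub (IsCalderon.tsum H hs))
      (by simp [hb, ha])
  refine squeeze_zero (fun _ => norm_nonneg _) hbound ?_
  simpa using (tendsto_iff_norm_sub_tendsto_zero.1 hg.hasSum).max
    (tendsto_iff_norm_sub_tendsto_zero.1 hh.hasSum)

instance : CompleteSpace (Interp ι θ) := by
  refine NormedAddCommGroup.completeSpace_of_summable_imp_tendsto fun a ha => ?_
  have hex : ∀ n, ∃ f g h, IsCalderon ι f g h ∧ f ((θ : ℝ) : ℂ) = val ι θ (a n) ∧
      max ‖g‖ ‖h‖ < ‖a n‖ + (1 / 2) ^ n := fun n =>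
    exists_of_lt (lt_add_of_pos_right _ (by positivity))
  choose f g h H hf hlt using hex
  have hs : Summable fun n => max ‖g n‖ ‖h n‖ :=
    .of_nonneg_of_le (fun n => le_max_of_le_left (norm_nonneg _)) (fun n => (hlt n).le)
      (ha.add summable_geometric_two)
  obtain ⟨b, hb⟩ := exists_hasSum_of_isCalderon H hs hf
  exact ⟨b, hb.tendsto_sum_nat⟩

end Interp

variable {H : Type*} [NormedAddCommGroup H] [InnerProductSpace ℂ H] [CompleteSpace H]

instance (N : VonNeumannAlgebra H) : CompleteSpace (El N) := by
  have h : IsClosed (N.carrier : Set (H →L[ℂ] H)) := by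
    rw [← N.centralizer_centralizer']
    exact Set.isClosed_centralizer _
  exact h.completeSpace_coe

instance (N : VonNeumannAlgebra H) : CompleteSpace (Predual N) :=
  (predual_isClosed N).completeSpace_coe

end Completeness

section Decomposition

variable {X : Type*} [NormedAddCommGroup X] [NormedSpace ℂ X]

/-- The space of the sequences of partial sums of convergent series `∑ y s` with `y s ∈ V s`.
A convergent sequence is encoded, together with its limit, as a continuous function on `ℕ ∪ {∞}`;
with the supremum norm the space is complete if `X` is and the `V s` are closed. -/
def partialSums (V : ℕ → Submodule ℂ X) : Submodule ℂ C(OnePoint ℕ, X) where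
  carrier := {f | f (0 : ℕ) = 0 ∧ ∀ s : ℕ, f (s + 1 : ℕ) - f s ∈ V s}
  zero_mem' := by simp
  add_mem' := by
    rintro f g ⟨hf, hf'⟩ ⟨hg, hg'⟩
    exact ⟨by simp [hf, hg],
      fun s => by simpa [add_sub_add_comm] using (V s).add_mem (hf' s) (hg' s)⟩
  smul_mem' := by
    rintro c f ⟨hf, hf'⟩
    exact ⟨by simp [hf], fun s => by simpa [smul_sub] using (V s).smul_mem c (hf' s)⟩

variable {V : ℕ → Submodule ℂ X}

theorem isClosed_partialSums (hV : ∀ s, IsClosed (V s : Set X)) :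
    IsClosed (partialSums V : Set C(OnePoint ℕ, X)) := by
  have hsplit : (partialSums V : Set C(OnePoint ℕ, X)) = {f | f (0 : ℕ) = 0} ∩
      ⋂ s : ℕ, (fun f : C(OnePoint ℕ, X) => f (s + 1 : ℕ) - f s) ⁻¹' V s := by
    ext f
    simp [partialSums]
  rw [hsplit]
  exact (isClosed_eq (continuous_eval_const _) continuous_const).inter
    (isClosed_iInter fun s => (hV s).preimage (by fun_prop))

theorem sum_sub_of_mem_partialSums {f : C(OnePoint ℕ, X)} (hf : f ∈ partialSums V) (n : ℕ) :
    ∑ s ∈ Finset.range n, (f (s + 1 : ℕ) - f s) = f n := by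
  rw [Finset.sum_range_sub (fun s : ℕ => f s), hf.1, sub_zero]

theorem tendsto_sum_sub_of_mem_partialSums {f : C(OnePoint ℕ, X)} (hf : f ∈ partialSums V) :
    Tendsto (fun n => ∑ s ∈ Finset.range n, (f (s + 1 : ℕ) - f s)) atTop
      (𝓝 (f OnePoint.infty)) := by
  simpa only [sum_sub_of_mem_partialSums hf] using
    (OnePoint.continuous_iff_from_nat f).1 f.continuous

/-- The evaluation of a sequence of partial sums at a point of `ℕ ∪ {∞}`; at `∞` it is the sum of
the series. -/
def evalPartialSums (V : ℕ → Submodule ℂ X) (k : OnePoint ℕ) : partialSums V →L[ℂ] X :=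
  ContinuousMap.evalCLM ℂ k ∘L (partialSums V).subtypeL

namespace IsSchauderDecomposition

theorem eq_of_tendsto (hV : IsSchauderDecomposition V) {y z : ℕ → X} {x : X}
    (hy : ∀ s, y s ∈ V s) (hz : ∀ s, z s ∈ V s)
    (hyx : Tendsto (fun n => ∑ s ∈ Finset.range n, y s) atTop (𝓝 x))
    (hzx : Tendsto (fun n => ∑ s ∈ Finset.range n, z s) atTop (𝓝 x)) : y = z :=
  (hV.existsUnique x).unique ⟨hy, hyx⟩ ⟨hz, hzx⟩

theorem injective_evalPartialSums_infty (hV : IsSchauderDecomposition V) :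
    Function.Injective (evalPartialSums V OnePoint.infty) := by
  intro f g (hfg : f.1 OnePoint.infty = g.1 OnePoint.infty)
  have hterms := hV.eq_of_tendsto f.2.2 g.2.2 (tendsto_sum_sub_of_mem_partialSums f.2)
    (hfg ▸ tendsto_sum_sub_of_mem_partialSums g.2)
  refine Subtype.ext (ContinuousMap.ext fun k => ?_)
  induction k using OnePoint.rec with
  | infty => exact hfg
  | coe n =>
    rw [← sum_sub_of_mem_partialSums f.2, ← sum_sub_of_mem_partialSums g.2]
    exact Finset.sum_congr rfl fun s _ => congrFun hterms s

theorem surjective_evalPartialSums_infty (hV : IsSchauderDecomposition V) :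
    Function.Surjective (evalPartialSums V OnePoint.infty) := by
  intro x
  obtain ⟨y, ⟨hy, hyx⟩, -⟩ := hV.existsUnique x
  refine ⟨⟨OnePoint.continuousMapMkNat _ x hyx, ?_, fun s => ?_⟩, rfl⟩
  · exact Finset.sum_range_zero y
  · change ∑ t ∈ Finset.range (s + 1), y t - ∑ t ∈ Finset.range s, y t ∈ V s
    rw [Finset.sum_range_succ, add_sub_cancel_left]
    exact hy s

variable [CompleteSpace X]

/-- The sequence of partial sums of the expansion of a vector, as a bounded operator: the inverse,
bounded by the open mapping theorem, of the summation of series with terms in the `V s`. -/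
def expansion (hV : IsSchauderDecomposition V) : X →L[ℂ] partialSums V :=
  have : CompleteSpace (partialSums V) := (isClosed_partialSums hV.isClosed).completeSpace_coe
  (ContinuousLinearEquiv.ofBijective (evalPartialSums V OnePoint.infty)
    (LinearMap.ker_eq_bot.2 hV.injective_evalPartialSums_infty)
    (LinearMap.range_eq_top.2 hV.surjective_evalPartialSums_infty)).symm

theorem expansion_apply_infty (hV : IsSchauderDecomposition V) (x : X) :
    (hV.expansion x).1 OnePoint.infty = x :=
  have : CompleteSpace (partialSums V) := (isClosed_partialSums hV.isClosed).completeSpace_coe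
  ContinuousLinearEquiv.ofBijective_apply_symm_apply (evalPartialSums V OnePoint.infty) _ _ x

/-- The projection of `X` onto `V s` which maps a vector to the `s`-th term of its expansion. -/
def component (hV : IsSchauderDecomposition V) (s : ℕ) : X →L[ℂ] X :=
  (evalPartialSums V (s + 1 : ℕ) - evalPartialSums V s) ∘L hV.expansion

theorem component_mem (hV : IsSchauderDecomposition V) (s : ℕ) (x : X) :
    hV.component s x ∈ V s :=
  (hV.expansion x).2.2 s

theorem sum_component (hV : IsSchauderDecomposition V) (n : ℕ) (x : X) :
    ∑ s ∈ Finset.range n, hV.component s x = (hV.expansion x).1 n :=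
  sum_sub_of_mem_partialSums (hV.expansion x).2 n

theorem tendsto_sum_component (hV : IsSchauderDecomposition V) (x : X) :
    Tendsto (fun n => ∑ s ∈ Finset.range n, hV.component s x) atTop (𝓝 x) := by
  have h := tendsto_sum_sub_of_mem_partialSums (hV.expansion x).2
  rwa [hV.expansion_apply_infty] at h

theorem norm_sum_component_le (hV : IsSchauderDecomposition V) (n : ℕ) (x : X) :
    ‖∑ s ∈ Finset.range n, hV.component s x‖ ≤ ‖hV.expansion‖ * ‖x‖ := by
  rw [hV.sum_component]
  exact ((hV.expansion x).1.norm_coe_le_norm _).trans (hV.expansion.le_opNorm x)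

theorem tendsto_component (hV : IsSchauderDecomposition V) (x : X) :
    Tendsto (fun s => hV.component s x) atTop (𝓝 0) := by
  simpa [Function.comp_def, Finset.sum_range_succ] using
    ((hV.tendsto_sum_component x).comp (tendsto_add_atTop_nat 1)).sub (hV.tendsto_sum_component x)

theorem component_eq_of_tendsto (hV : IsSchauderDecomposition V) {y : ℕ → X} {x : X}
    (hy : ∀ s, y s ∈ V s) (hyx : Tendsto (fun n => ∑ s ∈ Finset.range n, y s) atTop (𝓝 x))
    (s : ℕ) : hV.component s x = y s :=
  congrFun (hV.eq_of_tendsto (hV.component_mem · x) hy (hV.tendsto_sum_component x) hyx) s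

theorem component_of_mem (hV : IsSchauderDecomposition V) {t : ℕ} {x : X} (hx : x ∈ V t) (s : ℕ) :
    hV.component s x = (Pi.single t x : ℕ → X) s := by
  refine hV.component_eq_of_tendsto (fun s => ?_) (tendsto_const_nhds.congr' ?_) s
  · rcases eq_or_ne s t with rfl | hst
    · simpa using hx
    · simp [hst]
  · filter_upwards [eventually_gt_atTop t] with n hn
    simp [Pi.single_apply, hn]

theorem commute_component (hV : IsSchauderDecomposition V) {T : X →L[ℂ] X}
    (hT : ∀ s, ∀ x ∈ V s, T x ∈ V s) (s : ℕ) : Commute (hV.component s) T := by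
  ext x
  refine hV.component_eq_of_tendsto (y := fun s => T (hV.component s x))
    (fun s => hT s _ (hV.component_mem s x)) ?_ s
  simpa [Function.comp_def] using (T.continuous.tendsto x).comp (hV.tendsto_sum_component x)

theorem commute_component_component {F G : ℕ → X →L[ℂ] X}
    (hF : IsSchauderDecomposition fun j => (F j).range)
    (hG : IsSchauderDecomposition fun i => (G i).range) (hFG : ∀ i j, Commute (F j) (G i))
    (i j : ℕ) : Commute (hG.component i) (hF.component j) := by
  have hFcomp : ∀ i, Commute (hF.component j) (G i) := fun i =>
    hF.commute_component (by
      rintro j _ ⟨y, rfl⟩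
      exact ⟨G i y, DFunLike.congr_fun (hFG i j).eq y⟩) j
  refine hG.commute_component ?_ i
  rintro i _ ⟨y, rfl⟩
  exact ⟨hF.component j y, (DFunLike.congr_fun (hFcomp i).eq y).symm⟩

end IsSchauderDecomposition

end Decomposition

section Shell

theorem shell_of_le {i j : ℕ} (h : i ≤ j) : shell i j = j ^ 2 + i := if_pos h

theorem shell_of_lt {i j : ℕ} (h : j < i) : shell i j = (i + 1) ^ 2 - (j + 1) := by
  rw [shell, if_neg h.not_ge, Nat.sub_sub]

theorem sum_range_sq_add {E : Type*} [AddCommMonoid E] (a : ℕ → E) {l r : ℕ} (hr : r ≤ l + 1) :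
    ∑ k ∈ Finset.range (l ^ 2 + r), a k
      = ∑ k ∈ Finset.range (l ^ 2), a k + ∑ i ∈ Finset.range r, a (shell i l) := by
  rw [Finset.sum_range_add]
  congr 1
  refine Finset.sum_congr rfl fun i hi => ?_
  rw [shell_of_le (Nat.lt_succ_iff.1 ((Finset.mem_range.1 hi).trans_le hr))]

theorem sum_range_succ_sq_sub_add {E : Type*} [AddCommMonoid E] (a : ℕ → E) {l r : ℕ}
    (hr : r ≤ l) :
    ∑ k ∈ Finset.range ((l + 1) ^ 2 - r), a k + ∑ j ∈ Finset.range r, a (shell l j)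
      = ∑ k ∈ Finset.range ((l + 1) ^ 2), a k := by
  induction r with
  | zero => simp
  | succ r ih =>
    have hpred : (l + 1) ^ 2 - r = (l + 1) ^ 2 - (r + 1) + 1 := by
      have := Nat.le_self_pow two_ne_zero (l + 1)
      omega
    rw [← ih (by omega), hpred, Finset.sum_range_succ, Finset.sum_range_succ,
      shell_of_lt (Nat.lt_of_succ_le hr), add_assoc, add_comm (a _)]

theorem sum_range_sq {E : Type*} [AddCommMonoid E] (a : ℕ → E) (l : ℕ) :
    ∑ k ∈ Finset.range (l ^ 2), a k
      = ∑ j ∈ Finset.range l, ∑ i ∈ Finset.range l, a (shell i j) := by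
  induction l with
  | zero => simp
  | succ l ih =>
    have hcol : (l + 1) ^ 2 - l = l ^ 2 + (l + 1) := by
      rw [add_sq]
      omega
    rw [← sum_range_succ_sq_sub_add a le_rfl, hcol, sum_range_sq_add a le_rfl, ih]
    simp only [Finset.sum_range_succ, Finset.sum_add_distrib]
    abel

theorem norm_sum_range_sub_le_of_sq_le {E : Type*} [SeminormedAddCommGroup E] {a : ℕ → E} {b : ℝ}
    {l : ℕ} (hcol : ∀ r, ‖∑ i ∈ Finset.range r, a (shell i l)‖ ≤ b)
    (hrow : ∀ r, ‖∑ j ∈ Finset.range r, a (shell l j)‖ ≤ b)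
    (x : E) {n : ℕ} (hn : l ^ 2 ≤ n) (hn' : n < (l + 1) ^ 2) :
    ‖∑ k ∈ Finset.range n, a k - x‖ ≤ b + (‖∑ k ∈ Finset.range (l ^ 2), a k - x‖
      + ‖∑ k ∈ Finset.range ((l + 1) ^ 2), a k - x‖) := by
  have hsq : (l + 1) ^ 2 = l ^ 2 + (l + 1) + l := by ring
  rcases le_total n (l ^ 2 + (l + 1)) with h | h
  · obtain ⟨r, rfl⟩ := Nat.exists_eq_add_of_le hn
    rw [sum_range_sq_add a (by omega), add_sub_right_comm, add_comm]
    refine (norm_add_le _ _).trans (add_le_add (hcol r) ?_)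
    exact le_add_of_nonneg_right (norm_nonneg _)
  · obtain ⟨r, hr⟩ := Nat.exists_eq_add_of_le hn'.le
    obtain rfl : n = (l + 1) ^ 2 - r := by omega
    rw [eq_sub_of_add_eq (sum_range_succ_sq_sub_add a (show r ≤ l by omega)), sub_right_comm,
      sub_eq_neg_add]
    refine (norm_add_le _ _).trans (add_le_add ((norm_neg _).trans_le (hrow r)) ?_)
    exact le_add_of_nonneg_left (norm_nonneg _)

theorem tendsto_sum_range_of_tendsto_sq {E : Type*} [SeminormedAddCommGroup E] {a : ℕ → E}
    {b : ℕ → ℝ} {x : E} (hb : Tendsto b atTop (𝓝 0))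
    (hcol : ∀ l r, ‖∑ i ∈ Finset.range r, a (shell i l)‖ ≤ b l)
    (hrow : ∀ l r, ‖∑ j ∈ Finset.range r, a (shell l j)‖ ≤ b l)
    (hx : Tendsto (fun l => ∑ k ∈ Finset.range (l ^ 2), a k) atTop (𝓝 x)) :
    Tendsto (fun n => ∑ k ∈ Finset.range n, a k) atTop (𝓝 x) := by
  rw [tendsto_iff_norm_sub_tendsto_zero] at hx ⊢
  have hsqrt : Tendsto Nat.sqrt atTop atTop :=
    tendsto_atTop.2 fun m => (eventually_ge_atTop (m ^ 2)).mono fun n => Nat.le_sqrt'.2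
  have hlim := (hb.add (hx.add (hx.comp (tendsto_add_atTop_nat 1)))).comp hsqrt
  simp only [add_zero] at hlim
  exact squeeze_zero (fun _ => norm_nonneg _) (fun n => norm_sum_range_sub_le_of_sq_le (hcol n.sqrt)
    (hrow n.sqrt) x (Nat.sqrt_le' n) (Nat.lt_succ_sqrt' n)) hlim

end Shell

section Basis

theorem range_inf_range_eq_span {R E : Type*} [Semiring R] [AddCommMonoid E] [Module R E]
    {F G : E →ₗ[R] E} {e : E} (hF : IsIdempotentElem F) (hG : IsIdempotentElem G)
    (hFe : F e = e) (hGe : G e = e) (hFG : ∀ x, F (G x) ∈ Submodule.span R {e}) :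
    F.range ⊓ G.range = Submodule.span R {e} := by
  refine le_antisymm ?_ ?_
  · rintro x ⟨hFx, hGx⟩
    have h := hFG x
    rwa [(LinearMap.IsIdempotentElem.mem_range_iff hG).1 hGx,
      (LinearMap.IsIdempotentElem.mem_range_iff hF).1 hFx] at h
  · rw [Submodule.span_singleton_le_iff_mem]
    exact ⟨⟨e, hFe⟩, ⟨e, hGe⟩⟩

namespace IsSchauderDecomposition

variable {X : Type*} [NormedAddCommGroup X] [NormedSpace ℂ X] [CompleteSpace X]
  {V W : ℕ → Submodule ℂ X}

theorem tendsto_sum_component_sum_component (hV : IsSchauderDecomposition V)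
    (hW : IsSchauderDecomposition W) (x : X) :
    Tendsto (fun l => ∑ j ∈ Finset.range l, hV.component j
      (∑ i ∈ Finset.range l, hW.component i x)) atTop (𝓝 x) := by
  have herr : Tendsto (fun l => ∑ j ∈ Finset.range l, hV.component j
      (∑ i ∈ Finset.range l, hW.component i x - x)) atTop (𝓝 0) := by
    refine squeeze_zero_norm (fun l => hV.norm_sum_component_le l _) ?_
    simpa using (tendsto_iff_norm_sub_tendsto_zero.1 (hW.tendsto_sum_component x)).const_mul
      ‖hV.expansion‖
  simpa only [map_sub, Finset.sum_sub_distrib, sub_add_cancel, zero_add] using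
    herr.add (hV.tendsto_sum_component x)

theorem tendsto_sum_shell (hV : IsSchauderDecomposition V) (hW : IsSchauderDecomposition W)
    (hVW : ∀ i j, Commute (hW.component i) (hV.component j)) {x : X} {a : ℕ → X}
    (ha : ∀ i j, a (shell i j) = hW.component i (hV.component j x)) :
    Tendsto (fun n => ∑ k ∈ Finset.range n, a k) atTop (𝓝 x) := by
  have ha' : ∀ i j, a (shell i j) = hV.component j (hW.component i x) := fun i j =>
    (ha i j).trans (DFunLike.congr_fun (hVW i j).eq x)
  have hb : Tendsto (fun l => ‖hW.expansion‖ * ‖hV.component l x‖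
      + ‖hV.expansion‖ * ‖hW.component l x‖) atTop (𝓝 0) := by
    simpa using ((hV.tendsto_component x).norm.const_mul _).add
      ((hW.tendsto_component x).norm.const_mul _)
  refine tendsto_sum_range_of_tendsto_sq hb (fun l r => ?_) (fun l r => ?_) ?_
  · simp only [ha]
    exact le_add_of_le_of_nonneg (hW.norm_sum_component_le r _) (by positivity)
  · simp only [ha']
    exact le_add_of_nonneg_of_le (by positivity) (hV.norm_sum_component_le r _)
  · simpa only [sum_range_sq, ha', map_sum] using hV.tendsto_sum_component_sum_component hW x

theorem component_component_of_mem (hV : IsSchauderDecomposition V)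
    (hW : IsSchauderDecomposition W) {q : ℕ × ℕ} {x : X} (hx : x ∈ V q.2 ⊓ W q.1) (r : ℕ × ℕ) :
    hW.component r.1 (hV.component r.2 x) = (Pi.single q x : ℕ × ℕ → X) r := by
  rw [hV.component_of_mem hx.1]
  rcases eq_or_ne r.2 q.2 with h | h
  · rw [h, Pi.single_eq_same, hW.component_of_mem hx.2]
    simp only [Pi.single_apply, Prod.ext_iff, h, and_true]
  · simp [Prod.ext_iff, h]

theorem exists_schauderBasis_shell (hV : IsSchauderDecomposition V)
    (hW : IsSchauderDecomposition W) (hVW : ∀ i j, Commute (hW.component i) (hV.component j))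
    {e : ℕ → ℕ → X} (he : ∀ i j, e i j ≠ 0)
    (hspan : ∀ i j, V j ⊓ W i = Submodule.span ℂ {e i j}) :
    ∃ b : SchauderBasis ℂ X, ∀ i j, b (shell i j) = e i j := by
  choose f hf using fun i j => SeparatingDual.exists_eq_one (R := ℂ) (he i j)
  have hterm : ∀ i j x, f i j (hW.component i (hV.component j x)) • e i j
      = hW.component i (hV.component j x) := fun i j x => by
    have hmem : hW.component i (hV.component j x) ∈ V j ⊓ W i :=
      ⟨DFunLike.congr_fun (hVW i j).eq x ▸ hV.component_mem j (hW.component i x),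
        hW.component_mem i _⟩
    rw [hspan] at hmem
    obtain ⟨c, hc⟩ := Submodule.mem_span_singleton.1 hmem
    rw [← hc, map_smul, hf, smul_eq_mul, mul_one]
  have hmem : ∀ i j, e i j ∈ V j ⊓ W i := fun i j =>
    hspan i j ▸ Submodule.mem_span_singleton_self _
  let σ : ℕ × ℕ ≃ ℕ := Equiv.ofBijective _ shell_bijective
  have hσ : ∀ i j, σ.symm (shell i j) = (i, j) := fun i j => σ.symm_apply_apply (i, j)
  refine ⟨⟨fun k => e (σ.symm k).1 (σ.symm k).2,
    fun k => f (σ.symm k).1 (σ.symm k).2 ∘L hW.component (σ.symm k).1 ∘L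
      hV.component (σ.symm k).2, fun k l => ?_, fun x => ?_⟩, fun i j => by simp [hσ]⟩
  · simp only [ContinuousLinearMap.comp_apply,
      hV.component_component_of_mem hW (hmem (σ.symm l).1 (σ.symm l).2)]
    rcases eq_or_ne k l with rfl | hkl
    · simp [hf]
    · simp [hkl]
  · rw [HasSum, SummationFilter.conditional_filter_eq_map_range, tendsto_map'_iff]
    exact hV.tendsto_sum_shell hW hVW fun i j => by simp [hσ, hterm]

end IsSchauderDecomposition

end Basis

section ProjectionFormulas

variable {H : Type*} [NormedAddCommGroup H] [InnerProductSpace ℂ H] [CompleteSpace H]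

/-- The inclusion of `L^p(N)` in the predual of `N`. -/
def Lp.toPredual {N : VonNeumannAlgebra H} {ω : Predual N} {p : ℝ≥0∞} [Fact (1 ≤ p)]
    (x : Lp N ω p) : Predual N :=
  Interp.val (A₀ := El N) (A₁ := Predual N) (leftInj N ω) (param p) x

theorem Lp.ext {N : VonNeumannAlgebra H} {ω : Predual N} {p : ℝ≥0∞} [Fact (1 ≤ p)]
    {x y : Lp N ω p} (h : ∀ z, x.toPredual z = y.toPredual z) : x = y :=
  Interp.val_injective (Predual.ext h)

theorem toPredual_smul {N : VonNeumannAlgebra H} {ω : Predual N} {p : ℝ≥0∞} [Fact (1 ≤ p)]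
    (c : ℂ) (x : Lp N ω p) (y : El N) : (c • x).toPredual y = c * x.toPredual y := rfl

theorem toPredual_toLp (N : VonNeumannAlgebra H) (ω : Predual N) (p : ℝ≥0∞) [Fact (1 ≤ p)]
    (x y : El N) : (toLp N ω p x).toPredual y = ω (y * x) := rfl

variable {K : Type*} [NormedAddCommGroup K] [InnerProductSpace ℂ K] [CompleteSpace K]
  {N : VonNeumannAlgebra H} {M : VonNeumannAlgebra K} {φ : Predual N} {ψ : Predual M}
  {p : ℝ≥0∞} [Fact (1 ≤ p)]

theorem tmulEl_smul_left (c : ℂ) (x : El N) (y : El M) : tmulEl (c • x) y = c • tmulEl x y :=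
  El.ext (htensor_ext fun a b => by simp)

theorem tmulEl_smul_right (c : ℂ) (x : El N) (y : El M) : tmulEl x (c • y) = c • tmulEl x y :=
  El.ext (htensor_ext fun a b => by simp)

theorem apply_sliceToLeft_mul (u : El N) (v : El M) (y : El (vnTensor N M)) :
    φ (sliceToLeft N ψ.toDual (y * tmulEl 1 v) * u) = prodFunctional φ ψ (y * tmulEl u v) := by
  rw [prodFunctional_apply, ← sliceToLeft_mul_right, mul_assoc, tmulEl_mul, one_mul, mul_one]

theorem apply_sliceToRight_mul (u : El N) (v : El M) (y : El (vnTensor N M)) :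
    ψ (sliceToRight M φ.toDual (y * tmulEl u 1) * v) = prodFunctional φ ψ (y * tmulEl u v) := by
  rw [prodFunctional_apply', ← sliceToRight_mul_right, mul_assoc, tmulEl_mul, one_mul, mul_one]

theorem toPredual_projLeft (v : El M) (x : Lp (vnTensor N M) (prodFunctional φ ψ) p)
    (y : El (vnTensor N M)) :
    (projLeft φ ψ p v x).toPredual y
      = x.toPredual (tmulEl (sliceToLeft N ψ.toDual (y * tmulEl 1 v)) (star v)) := by
  change x.toPredual (tmulEl (sliceToLeft N ψ.toDual (y * tmulEl 1 v)) 1 * tmulEl 1 (star v)) = _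
  rw [tmulEl_mul, mul_one, one_mul]

theorem toPredual_projRight (u : El N) (x : Lp (vnTensor N M) (prodFunctional φ ψ) p)
    (y : El (vnTensor N M)) :
    (projRight φ ψ p u x).toPredual y
      = x.toPredual (tmulEl (star u) (sliceToRight M φ.toDual (y * tmulEl u 1))) := by
  change x.toPredual (tmulEl 1 (sliceToRight M φ.toDual (y * tmulEl u 1)) * tmulEl (star u) 1) = _
  rw [tmulEl_mul, mul_one, one_mul]

theorem projLeft_projLeft (v : El M) (x : Lp (vnTensor N M) (prodFunctional φ ψ) p) :
    projLeft φ ψ p v (projLeft φ ψ p v x) = ψ (star v * v) • projLeft φ ψ p v x := by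
  refine Lp.ext fun y => ?_
  rw [toPredual_projLeft, toPredual_projLeft, tmulEl_mul, mul_one, sliceToLeft_tmul,
    tmulEl_smul_left, map_smul, smul_eq_mul, toPredual_smul, toPredual_projLeft]

theorem projRight_projRight (u : El N) (x : Lp (vnTensor N M) (prodFunctional φ ψ) p) :
    projRight φ ψ p u (projRight φ ψ p u x) = φ (star u * u) • projRight φ ψ p u x := by
  refine Lp.ext fun y => ?_
  rw [toPredual_projRight, toPredual_projRight, tmulEl_mul, mul_one, sliceToRight_tmul,
    tmulEl_smul_right, map_smul, smul_eq_mul, toPredual_smul, toPredual_projRight]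

theorem projLeft_projRight (u : El N) (v : El M)
    (x : Lp (vnTensor N M) (prodFunctional φ ψ) p) :
    projLeft φ ψ p v (projRight φ ψ p u x) = x.toPredual (tmulEl (star u) (star v)) •
      toLp (vnTensor N M) (prodFunctional φ ψ) p (tmulEl u v) := by
  refine Lp.ext fun y => ?_
  rw [toPredual_projLeft, toPredual_projRight, tmulEl_mul, mul_one, sliceToRight_tmul,
    apply_sliceToLeft_mul, tmulEl_smul_right, map_smul, toPredual_smul, toPredual_toLp,
    smul_eq_mul, mul_comm]

theorem projRight_projLeft (u : El N) (v : El M)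
    (x : Lp (vnTensor N M) (prodFunctional φ ψ) p) :
    projRight φ ψ p u (projLeft φ ψ p v x) = x.toPredual (tmulEl (star u) (star v)) •
      toLp (vnTensor N M) (prodFunctional φ ψ) p (tmulEl u v) := by
  refine Lp.ext fun y => ?_
  rw [toPredual_projRight, toPredual_projLeft, tmulEl_mul, mul_one, sliceToLeft_tmul,
    apply_sliceToRight_mul, tmulEl_smul_left, map_smul, toPredual_smul, toPredual_toLp,
    smul_eq_mul, mul_comm]

theorem projLeft_toLp_tmulEl (u : El N) (v w : El M) :
    projLeft φ ψ p v (toLp (vnTensor N M) (prodFunctional φ ψ) p (tmulEl u w))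
      = ψ (star v * w) • toLp (vnTensor N M) (prodFunctional φ ψ) p (tmulEl u v) := by
  refine Lp.ext fun y => ?_
  rw [toPredual_projLeft, toPredual_toLp, tmulEl_mul, prodFunctional_tmul, apply_sliceToLeft_mul,
    toPredual_smul, toPredual_toLp, mul_comm]

theorem projRight_toLp_tmulEl (u w : El N) (v : El M) :
    projRight φ ψ p u (toLp (vnTensor N M) (prodFunctional φ ψ) p (tmulEl w v))
      = φ (star u * w) • toLp (vnTensor N M) (prodFunctional φ ψ) p (tmulEl u v) := by
  refine Lp.ext fun y => ?_
  rw [toPredual_projRight, toPredual_toLp, tmulEl_mul, prodFunctional_tmul,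
    apply_sliceToRight_mul, toPredual_smul, toPredual_toLp]

theorem commute_projLeft_projRight (u : El N) (v : El M) :
    Commute (projLeft φ ψ p v) (projRight φ ψ p u) :=
  ContinuousLinearMap.ext fun x =>
    (projLeft_projRight u v x).trans (projRight_projLeft u v x).symm

theorem isIdempotentElem_projLeft {v : El M} (hv : ψ (star v * v) = 1) :
    IsIdempotentElem (projLeft φ ψ p v) :=
  ContinuousLinearMap.ext fun x => (projLeft_projLeft v x).trans (by rw [hv, one_smul])

theorem isIdempotentElem_projRight {u : El N} (hu : φ (star u * u) = 1) :
    IsIdempotentElem (projRight φ ψ p u) :=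
  ContinuousLinearMap.ext fun x => (projRight_projRight u x).trans (by rw [hu, one_smul])

theorem toLp_tmulEl_ne_zero {u : El N} (hu : φ (star u * u) = 1) {v : El M}
    (hv : ψ (star v * v) = 1) :
    toLp (vnTensor N M) (prodFunctional φ ψ) p (tmulEl u v) ≠ 0 := by
  intro hzero
  have h := toPredual_toLp (vnTensor N M) (prodFunctional φ ψ) p (tmulEl u v)
    (tmulEl (star u) (star v))
  rw [tmulEl_mul, prodFunctional_tmul, hu, hv, mul_one, hzero] at h
  exact zero_ne_one h

theorem range_projLeft_inf_range_projRight {u : El N} (hu : φ (star u * u) = 1) {v : El M}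
    (hv : ψ (star v * v) = 1) :
    (projLeft φ ψ p v).range ⊓ (projRight φ ψ p u).range
      = Submodule.span ℂ {toLp (vnTensor N M) (prodFunctional φ ψ) p (tmulEl u v)} := by
  refine range_inf_range_eq_span
    (ContinuousLinearMap.IsIdempotentElem.toLinearMap (isIdempotentElem_projLeft hv))
    (ContinuousLinearMap.IsIdempotentElem.toLinearMap (isIdempotentElem_projRight hu))
    ?_ ?_ fun x => ?_
  · exact (projLeft_toLp_tmulEl u v v).trans (by rw [hv, one_smul])
  · exact (projRight_toLp_tmulEl u u v).trans (by rw [hu, one_smul])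
  · exact Submodule.mem_span_singleton.2 ⟨_, (projLeft_projRight u v x).symm⟩

end ProjectionFormulas

end NCLp

end

theorem mainTheorem5_general
    {H K : Type*} [NormedAddCommGroup H] [InnerProductSpace ℂ H] [CompleteSpace H]
    [NormedAddCommGroup K] [InnerProductSpace ℂ K] [CompleteSpace K]
    {N : VonNeumannAlgebra H} {M : VonNeumannAlgebra K}
    {φ : NCLp.Predual N} {ψ : NCLp.Predual M} {p : ℝ≥0∞} [Fact (1 ≤ p)]
    {u : ℕ → NCLp.El N} (hu : ∀ i, φ (star (u i) * u i) = 1)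
    {v : ℕ → NCLp.El M} (hv : ∀ j, ψ (star (v j) * v j) = 1)
    (hN : NCLp.IsSchauderDecomposition fun j => (NCLp.projLeft φ ψ p (v j)).range)
    (hM : NCLp.IsSchauderDecomposition fun i => (NCLp.projRight φ ψ p (u i)).range) :
    ∃ b : SchauderBasis ℂ (NCLp.Lp (NCLp.vnTensor N M) (NCLp.prodFunctional φ ψ) p),
      ∀ i j, b (NCLp.shell i j) =
        NCLp.toLp (NCLp.vnTensor N M) (NCLp.prodFunctional φ ψ) p (NCLp.tmulEl (u i) (v j)) :=
  hN.exists_schauderBasis_shell hM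
    (hN.commute_component_component hM fun i j => NCLp.commute_projLeft_projRight (u i) (v j))
    (fun i j => NCLp.toLp_tmulEl_ne_zero (hu i) (hv j))
    (fun i j => NCLp.range_projLeft_inf_range_projRight (hu i) (hv j))

theorem mainTheorem5
    {H K : Type*} [NormedAddCommGroup H] [InnerProductSpace ℂ H] [CompleteSpace H]
    [NormedAddCommGroup K] [InnerProductSpace ℂ K] [CompleteSpace K]
    (N : VonNeumannAlgebra H) (M : VonNeumannAlgebra K)
    (φ : NCLp.Predual N) (hφ : NCLp.IsFaithfulState φ)
    (ψ : NCLp.Predual M) (hψ : NCLp.IsFaithfulState ψ)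
    (p : ℝ≥0∞) [Fact (1 ≤ p)]
    (u : ℕ → NCLp.El N) (hu : ∀ i, u i ∈ unitary (NCLp.El N)) (hu' : LinearIndependent ℂ u)
    (v : ℕ → NCLp.El M) (hv : ∀ j, v j ∈ unitary (NCLp.El M)) (hv' : LinearIndependent ℂ v)
    (hN : NCLp.IsSchauderDecomposition fun j => (NCLp.projLeft φ ψ p (v j)).range)
    (hM : NCLp.IsSchauderDecomposition fun i => (NCLp.projRight φ ψ p (u i)).range) :
    ∃ b : SchauderBasis ℂ (NCLp.Lp (NCLp.vnTensor N M) (NCLp.prodFunctional φ ψ) p),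
      ∀ i j, b (NCLp.shell i j) =
        NCLp.toLp (NCLp.vnTensor N M) (NCLp.prodFunctional φ ψ) p (NCLp.tmulEl (u i) (v j)) :=
  mainTheorem5_general (fun i => by rw [Unitary.star_mul_self_of_mem (hu i), hφ.map_one])
    (fun j => by rw [Unitary.star_mul_self_of_mem (hv j), hψ.map_one]) hN hM
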